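/- Let $G=(V,E)$ be a finite connected graph drawn in the Euclidean plane with distinct points as nodes and straight segments as edges, such that two different edges meet only in a common end node. A *face* is a path component of the complement of the union of the edges. Let $s,d\in V$, and let $(s,d)$ be the open segment from $s$ to $d$. *Algorithm 2FACE.* Tokens $R$ and $L$ travel around faces. An $R$ token that arrives at a node $a$ from $b$ is passed on along the next edge at $a$ clockwise after $ab$, an $L$ token along the next edge counterclockwise; an $R$ token thus keeps its face on the left, an $L$ token on the right. Places on the boundary of a face are the corners at nodes, i.e. the sectors between consecutive edges at a node (a node can occur on the boundary of a face more than once). An edge that intersects $(s,d)$ and has on its two sides two distinct faces that both intersect $(s,d)$ makes one or both of its end nodes (an arbitrary choice for every such edge) an *entry point* to these two faces, at the two corners beside the edge; and $s$ is an entry point to the first face that intersects $(s,d)$, at the corner from which $(s,d)$ starts. Every node has a send queue. To start a face at a corner, a node puts into its queue one $R$ and one $L$ token that leave this corner around the face in the two directions. First $s$ starts all faces to which it is an entry point. Then, in every step, an arbitrary token from an arbitrary queue is sent, and it is received and processed at once. If the receiver has in its queue the token of the opposite rule of the same face that would be sent back along the same side of the same edge, both tokens are deleted. Otherwise, if the receiver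 is not $d$ and the token arrives at one of its entry corners, the receiver starts the faces at all its other entry corners; and in any case it puts the received token, to be passed on along its face, into its queue. A message is one sending of a token. Message $m'$ *causally follows* $m$ if there are messages $m=m_0,m_1,\dots,m_k=m'$, $k\ge 1$, such that each $m_{i+1}$ is sent by the receiver of $m_i$ after the receipt of $m_i$. *Statement.* There is an absolute constant $C$ such that for all such $G$, $s$, $d$, all choices of entry points and all computations of 2FACE: 1. (message complexity $O(|E|)$) at most $C\,|E|$ messages are sent; 2. (time complexity $O(|V|)$) every chain of messages in which each message causally follows the previous one has length at most $C\,|V|$; 3. if no node lies on $(s,d)$, then in every complete computation (one at whose end no token is left in any queue) the number of messages is exactly $\sum_F e(F)$, where $F$ ranges over the faces that intersect $(s,d)$ and $e(F)$ is the number of edges of $F$, an edge with $F$ on both of its sides being counted twice. -/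

import Mathlib

namespace TwoFace

/-- A geometric graph: the nodes are distinct points of the Euclidean plane, modelled as `ℂ`, and
every edge is drawn as the straight segment between its end nodes. -/
structure GeomGraph (V : Type*) where
  graph : SimpleGraph V
  pos : V → ℂ
  pos_injective : Function.Injective pos

namespace GeomGraph

variable {V : Type*} (G : GeomGraph V)

/-- An edge together with a direction of travel. -/
abbrev Dart := G.graph.Dart

/-- Edges intersect only at vertices: two different edges meet only in a common end node. -/
def IsPlanar : Prop :=
  ∀ ⦃a b c e : V⦄, G.graph.Adj a b → G.graph.Adj c e → s(a, b) ≠ s(c, e) →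
    ∀ z ∈ segment ℝ (G.pos a) (G.pos b) ∩ segment ℝ (G.pos c) (G.pos e),
      ∃ v, v ∈ s(a, b) ∧ v ∈ s(c, e) ∧ z = G.pos v

/-- The points of the plane that lie on edges. -/
def drawing : Set ℂ := {z | ∃ a b, G.graph.Adj a b ∧ z ∈ segment ℝ (G.pos a) (G.pos b)}

/-- A face: a maximal nonempty region any two points of which are joined by a curve that does not
intersect any edge. -/
def IsFace (F : Set ℂ) : Prop := ∃ z ∈ G.drawingᶜ, F = pathComponentIn G.drawingᶜ z

/-- The displacement along a dart. -/
def dir (x : G.Dart) : ℂ := G.pos x.snd - G.pos x.fst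

/-- `F` is the face that borders the edge of `x` on the left of the direction of `x`. -/
def IsLeftFace (x : G.Dart) (F : Set ℂ) : Prop :=
  G.IsFace F ∧ ∀ᶠ ε : ℝ in nhdsWithin 0 (Set.Ioi 0),
    (G.pos x.fst + G.pos x.snd) / 2 + ε * (Complex.I * G.dir x) ∈ F

/-- The number of edges of a face. An edge with `F` on both of its sides occurs twice on the
boundary of `F` and counts twice. -/
noncomputable def faceEdges (F : Set ℂ) : ℕ := Nat.card {x : G.Dart // G.IsLeftFace x F}

/-! ### The hand rules -/

/-- The clockwise angle, in `(0, 2π]`, from the direction of `u` to the direction of `v`. -/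
noncomputable def cwAngle (u v : ℂ) : ℝ := toIocMod Real.two_pi_pos 0 (Complex.arg (u / v))

theorem exists_min_dart [Finite V] (x : G.Dart) (f : G.Dart → ℝ) :
    ∃ y ∈ {y : G.Dart | y.fst = x.fst}, ∀ z ∈ {z : G.Dart | z.fst = x.fst}, f y ≤ f z := by
  have : Finite G.Dart :=
    Finite.of_injective (fun y : G.Dart => y.toProd) SimpleGraph.Dart.toProd_injective
  exact Set.exists_min_image _ f (Set.toFinite _) ⟨x, rfl⟩

/-- The next edge clockwise after `x` at the node `x.fst` (`x` itself if the degree is one). -/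
noncomputable def nextCW [Finite V] (x : G.Dart) : G.Dart :=
  (G.exists_min_dart x fun y => cwAngle (G.dir x) (G.dir y)).choose

/-- The next edge counterclockwise after `x` at the node `x.fst`. -/
noncomputable def nextCCW [Finite V] (x : G.Dart) : G.Dart :=
  (G.exists_min_dart x fun y => cwAngle (G.dir y) (G.dir x)).choose

end GeomGraph

/-- The right- and the left-hand rule. -/
inductive Rule
  | R
  | L

def Rule.opp : Rule → Rule
  | .R => .L
  | .L => .R

/-- A token waiting in the send queue of the node `dart.fst`, to be sent to `dart.snd`. It
traverses the face on the left of `dart` if it follows the right-hand rule, and the face on the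
right of `dart` if it follows the left-hand rule. -/
structure Token {V : Type*} (G : GeomGraph V) where
  rule : Rule
  dart : G.Dart

namespace Token

variable {V : Type*} {G : GeomGraph V}

def sender (t : Token G) : V := t.dart.fst

def receiver (t : Token G) : V := t.dart.snd

/-- The token that meets `t`: it goes around the same face in the opposite direction, and is about
to be sent back by the receiver of `t` along the same side of the edge on which `t` arrives. -/
def partner (t : Token G) : Token G := ⟨t.rule.opp, t.dart.symm⟩

/-- The token that the receiver of `t` retransmits around the same face. -/
noncomputable def next [Finite V] (t : Token G) : Token G :=
  match t.rule with
  | .R => ⟨.R, G.nextCW t.dart.symm⟩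
  | .L => ⟨.L, G.nextCCW t.dart.symm⟩

/-- The place on the boundary of its face at which `t` arrives. Such a place is a corner: the
sector at a node between an edge `κ` and the next edge counterclockwise, named by the dart `κ`
leaving the node. The corner `κ` lies in the face on the left of `κ`. -/
noncomputable def corner [Finite V] (t : Token G) : G.Dart :=
  match t.rule with
  | .R => G.nextCW t.dart.symm
  | .L => t.dart.symm

end Token

namespace GeomGraph

variable {V : Type*} (G : GeomGraph V) (s d : V)

/-- The line `(s, d)` from the source to the destination. -/
def line : Set ℂ := openSegment ℝ (G.pos s) (G.pos d)

/-- The faces that intersect the line `(s, d)`. -/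
def crossedFaces : Set (Set ℂ) := {F | G.IsFace F ∧ (F ∩ G.line s d).Nonempty}

/-- The edge of `x` borders two faces that intersect `(s, d)`, and it intersects `(s, d)`. -/
def IsEntryEdge (x : G.Dart) : Prop :=
  (∃ F F', F ≠ F' ∧ G.IsLeftFace x F ∧ G.IsLeftFace x.symm F' ∧
      F ∈ G.crossedFaces s d ∧ F' ∈ G.crossedFaces s d) ∧
    (segment ℝ (G.pos x.fst) (G.pos x.snd) ∩ G.line s d).Nonempty

/-- A choice of entry points: `x ∈ E` means that the node `x.fst` acts as an entry point to the two
faces at the edge of `x`. One end or both ends of every such edge act as entry points. -/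
def IsEntryChoice (E : Set G.Dart) : Prop :=
  (∀ x ∈ E, G.IsEntryEdge s d x) ∧ ∀ x, G.IsEntryEdge s d x → x ∈ E ∨ x.symm ∈ E

/-- The corner `κ` at the source from which the line `(s, d)` starts; it lies in the first face that
intersects `(s, d)`. -/
def IsSourceCorner (κ : G.Dart) : Prop :=
  κ.fst = s ∧
    (∀ y : G.Dart, y.fst = s →
      cwAngle (G.pos d - G.pos s) (G.dir κ) ≤ cwAngle (G.pos d - G.pos s) (G.dir y)) ∧
    ∃ F, G.IsLeftFace κ F ∧ ∀ᶠ ε : ℝ in nhdsWithin 0 (Set.Ioi 0),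
      G.pos s + ε * (G.pos d - G.pos s) ∈ F

/-- The node `κ.fst` is an entry point to the face at its corner `κ`: either it is the source, and
`κ` is the source corner, or `κ` is one of the two corners beside an edge for which the node acts as
an entry point. -/
def IsEntryCorner [Finite V] (E : Set G.Dart) (κ : G.Dart) : Prop :=
  G.IsSourceCorner s d κ ∨ ∃ x ∈ E, κ = x ∨ κ = G.nextCW x

/-- The pair of tokens that starts the traversal of a face at the corner `κ`. -/
noncomputable def pair [Finite V] (κ : G.Dart) : Multiset (Token G) :=
  {⟨.R, κ⟩, ⟨.L, G.nextCCW κ⟩}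

variable [Fintype V] (E : Set G.Dart)

open Classical in
/-- The entry corners at the node `n`. -/
noncomputable def entryCorners (n : V) : Finset G.Dart :=
  Finset.univ.filter fun κ => κ.fst = n ∧ G.IsEntryCorner s d E κ

/-- The tokens waiting after the first action of the source. The send queue `SQ` of a node `n`
consists of the waiting tokens `t` with `t.sender = n`. -/
noncomputable def init : Multiset (Token G) :=
  ∑ κ ∈ G.entryCorners s d E s, G.pair κ

open Classical in
/-- Receipt of the token `t` when the tokens in `c` are waiting: if the partner of `t` waits at the
receiver, both disappear. Otherwise the receiver, if it is not the destination and is an entry point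
to the face of `t`, starts the traversal of every other face to which it is an entry point; and it
retransmits `t`. -/
noncomputable def receive (c : Multiset (Token G)) (t : Token G) : Multiset (Token G) :=
  if t.partner ∈ c then c.erase t.partner
  else if t.receiver ≠ d ∧ t.corner ∈ G.entryCorners s d E t.receiver then
    c + ∑ κ ∈ (G.entryCorners s d E t.receiver).erase t.corner, G.pair κ + {t.next}
  else c + {t.next}

open Classical in
/-- `Computation s d E ms c`: there is a computation of 2FACE in which the messages `ms` have been
sent so far, in this order, and the tokens in `c` are waiting. In every step an arbitrary waiting
token is sent, and is at once received and processed. -/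
inductive Computation : List (Token G) → Multiset (Token G) → Prop
  | start : Computation [] (G.init s d E)
  | step (ms : List (Token G)) (c : Multiset (Token G)) (t : Token G) :
      Computation ms c → t ∈ c →
        Computation (ms ++ [t]) (G.receive s d E (c.erase t) t)

end GeomGraph

/-- The `j`-th message is sent by the receiver of the `i`-th message after that receipt. -/
def SentAfterReceipt {V : Type*} {G : GeomGraph V} (ms : List (Token G))
    (i j : Fin ms.length) : Prop :=
  i < j ∧ (ms.get j).sender = (ms.get i).receiver

/-- A chain of causally related messages, as a list of positions in `ms`: the send of every message
causally follows the receipt of the one before it. -/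
def IsCausalChain {V : Type*} {G : GeomGraph V} (ms : List (Token G))
    (l : List (Fin ms.length)) : Prop :=
  l.IsChain (Relation.TransGen (SentAfterReceipt ms))

end TwoFace

/-! ### Clockwise angles and the rotation at a node -/

namespace TwoFace

namespace GeomGraph

/-! Name each side of an edge by the dart that has it on the left. The rotation at the nodes yields
the permutation `faceNext` of the darts, and tokens walk forwards or backwards along its orbits. A
computation is governed by the set `S` of corners visited so far (`Invariant`): the waiting tokens
are exactly those that leave a corner of `S` along an unused side, and no side is used twice. Hence
there are at most as many messages as darts, that is 2|E|. Positions increase along a causal chain,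
so the time bound only needs |E| ≤ 3|V|.

This bound, and the link between faces and orbits, come from winding numbers. The angle swept around
a point by a conserved flow on the darts is constant on each face and jumps across an edge by 2π
times the net flow. So a conserved flow is a function of the left face plus a function invariant
under reversal of darts (`IsCycle.exists_potential`). Comparing dimensions gives |E| ≤ |V| + number
of orbits, and an orbit has at least three darts unless the graph is a single edge. Applied to the
indicator of a union of orbits in a connected graph, the same fact shows that the darts with a given
left face form one orbit (`IsPlanar.mem_iff_of_isLeftFace`).

When no token is left, `S` has as many elements as there were messages and consists of whole face
boundaries. All entry corners lie in crossed faces, so `S` contains no other boundaries. Conversely,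
`S` contains the first face on the segment, and at an edge the segment either stays in one face or
meets an entry edge, one of whose ends ties the visits of both faces together. As the segment is
connected, every crossed face is visited (`IsPlanar.mem_of_crossed`). -/

open Complex in
theorem cwAngle_pos (u v : ℂ) : 0 < cwAngle u v :=
  (toIocMod_mem_Ioc Real.two_pi_pos 0 (arg (u / v))).1

open Complex in
theorem cwAngle_le (u v : ℂ) : cwAngle u v ≤ 2 * Real.pi := by
  simpa [cwAngle] using (toIocMod_mem_Ioc Real.two_pi_pos 0 (arg (u / v))).2

-- Existence of the polar form of `u` relative to `v`; with the uniqueness in `cwAngle_eq_of_eq` it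
-- is all that is used about `cwAngle` besides its range.
open Complex in
theorem exists_eq_mul_exp_cwAngle {u v : ℂ} (hu : u ≠ 0) (hv : v ≠ 0) :
    ∃ ρ : ℝ, 0 < ρ ∧ u = ρ * exp (cwAngle u v * I) * v := by
  refine ⟨‖u / v‖, norm_pos_iff.2 (div_ne_zero hu hv), ?_⟩
  have h : exp (cwAngle u v * I) = exp (arg (u / v) * I) := by
    rw [Complex.exp_eq_exp_iff_exists_int]
    refine ⟨-toIocDiv Real.two_pi_pos 0 (arg (u / v)), ?_⟩
    rw [cwAngle, ← self_sub_toIocDiv_zsmul]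
    push_cast [zsmul_eq_mul]
    ring
  rw [h, norm_mul_exp_arg_mul_I, div_mul_cancel₀ _ hv]

open Complex in
theorem cwAngle_eq_of_eq {u v : ℂ} (hv : v ≠ 0) {ρ θ : ℝ} (hρ : 0 < ρ) (h0 : 0 < θ)
    (h1 : θ ≤ 2 * Real.pi) (h : u = ρ * exp (θ * I) * v) : cwAngle u v = θ := by
  have hu : u ≠ 0 := by
    rw [h]
    exact mul_ne_zero (mul_ne_zero (by exact_mod_cast hρ.ne') (exp_ne_zero _)) hv
  obtain ⟨σ, hσ, h'⟩ := exists_eq_mul_exp_cwAngle hu hv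
  have he : (ρ : ℂ) * exp (θ * I) = σ * exp (cwAngle u v * I) :=
    mul_right_cancel₀ hv (h.symm.trans h')
  have hn : ρ = σ := by
    have := congrArg norm he
    simpa [norm_exp_ofReal_mul_I, abs_of_pos hρ, abs_of_pos hσ] using this
  subst hn
  have he' := mul_left_cancel₀ (by exact_mod_cast hρ.ne' : (ρ : ℂ) ≠ 0) he
  obtain ⟨n, hn⟩ := Complex.exp_eq_exp_iff_exists_int.1 he'
  have hn' : θ = cwAngle u v + n * (2 * Real.pi) := by
    have : (θ : ℂ) = cwAngle u v + n * (2 * Real.pi) :=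
      mul_right_cancel₀ I_ne_zero (by rw [hn]; ring)
    exact_mod_cast this
  have a := cwAngle_pos u v
  have b := cwAngle_le u v
  have hp := Real.two_pi_pos
  have n1 : n < 1 := by
    by_contra! hc
    have : (1 : ℝ) ≤ n := by exact_mod_cast hc
    nlinarith
  have n2 : -1 < n := by
    by_contra! hc
    have : (n : ℝ) ≤ -1 := by exact_mod_cast hc
    nlinarith
  have : n = 0 := by omega
  subst this
  simpa using hn'.symm

open Complex in
/-- Clockwise angles to a common direction subtract. -/
theorem cwAngle_sub {u v w : ℂ} (hu : u ≠ 0) (hv : v ≠ 0) (hw : w ≠ 0)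
    (h : cwAngle v w < cwAngle u w) : cwAngle u v = cwAngle u w - cwAngle v w := by
  obtain ⟨ρ, hρ, h1⟩ := exists_eq_mul_exp_cwAngle hu hw
  obtain ⟨σ, hσ, h2⟩ := exists_eq_mul_exp_cwAngle hv hw
  have := cwAngle_le u w
  have := cwAngle_pos v w
  refine cwAngle_eq_of_eq hv (div_pos hρ hσ) (by linarith) (by linarith) ?_
  have hσ' : (σ : ℂ) ≠ 0 := by exact_mod_cast hσ.ne'
  generalize cwAngle u w = α at h1 ⊢
  generalize cwAngle v w = β at h2 ⊢
  have : exp (α * I) = exp (((α - β : ℝ) : ℂ) * I) * exp (β * I) := by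
    rw [← Complex.exp_add]
    push_cast
    ring_nf
  rw [h1, h2, this]
  push_cast
  field_simp

/-- Directions with equal clockwise angles to a third one are positively proportional. -/
theorem exists_eq_mul_of_cwAngle_eq {u v w : ℂ} (hu : u ≠ 0) (hv : v ≠ 0) (hw : w ≠ 0)
    (h : cwAngle u w = cwAngle v w) : ∃ ρ : ℝ, 0 < ρ ∧ u = ρ * v := by
  obtain ⟨ρ, hρ, h1⟩ := exists_eq_mul_exp_cwAngle hu hw
  obtain ⟨σ, hσ, h2⟩ := exists_eq_mul_exp_cwAngle hv hw
  refine ⟨ρ / σ, div_pos hρ hσ, ?_⟩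
  have hσ' : (σ : ℂ) ≠ 0 := by exact_mod_cast hσ.ne'
  conv_lhs => rw [h1, h]
  conv_rhs => rw [h2]
  push_cast
  field_simp

variable {V : Type*} {G : GeomGraph V}

theorem dir_ne_zero (x : G.Dart) : G.dir x ≠ 0 :=
  sub_ne_zero.2 fun h => x.adj.ne (G.pos_injective h).symm

@[simp] theorem dir_symm (x : G.Dart) : G.dir x.symm = -G.dir x := by
  simp [dir]

theorem pos_snd (x : G.Dart) : G.pos x.snd = G.pos x.fst + G.dir x := by
  simp [dir]

theorem mem_segment_iff (x : G.Dart) (z : ℂ) :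
    z ∈ segment ℝ (G.pos x.fst) (G.pos x.snd) ↔
      ∃ t : ℝ, 0 ≤ t ∧ t ≤ 1 ∧ z = G.pos x.fst + t * G.dir x := by
  rw [segment_eq_image']
  constructor
  · rintro ⟨t, ⟨h0, h1⟩, rfl⟩
    exact ⟨t, h0, h1, by simp [dir]⟩
  · rintro ⟨t, h0, h1, rfl⟩
    exact ⟨t, ⟨h0, h1⟩, by simp [dir]⟩

theorem dart_eq_of_fst_eq_of_edge_eq {x y : G.Dart} (h : x.fst = y.fst) (he : x.edge = y.edge) :
    x = y := by
  rcases SimpleGraph.dart_edge_eq_iff x y |>.1 he with h' | h'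
  · exact h'
  · subst h'
    exact absurd h y.adj.ne.symm

/-- An interior point of an edge lies on no other edge. -/
theorem IsPlanar.edge_eq_of_interior (hG : G.IsPlanar) {x y : G.Dart} {t : ℝ} (h0 : 0 < t)
    (h1 : t < 1)
    (hy : G.pos x.fst + t * G.dir x ∈ segment ℝ (G.pos y.fst) (G.pos y.snd)) :
    x.edge = y.edge := by
  by_contra hne
  obtain ⟨v, hv, -, hz⟩ := hG x.adj y.adj hne _
    ⟨(G.mem_segment_iff x _).2 ⟨t, h0.le, h1.le, rfl⟩, hy⟩
  rcases Sym2.mem_iff.1 hv with rfl | rfl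
  · have : (t : ℂ) * G.dir x = 0 := by simpa using hz
    rcases mul_eq_zero.1 this with h | h
    · exact h0.ne' (by exact_mod_cast h)
    · exact dir_ne_zero x h
  · rw [pos_snd] at hz
    have : ((t : ℂ) - 1) * G.dir x = 0 := by linear_combination hz
    rcases mul_eq_zero.1 this with h | h
    · have : (t : ℂ) = 1 := sub_eq_zero.1 h
      exact h1.ne (by exact_mod_cast this)
    · exact dir_ne_zero x h

/-- Different edges leave a node in different directions. -/
theorem IsPlanar.dart_eq_of_dir (hG : G.IsPlanar) {x y : G.Dart} (h : x.fst = y.fst) {ρ : ℝ}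
    (hρ : 0 < ρ) (hd : G.dir x = ρ * G.dir y) : x = y := by
  refine dart_eq_of_fst_eq_of_edge_eq h ?_
  have hm : 0 < min 1 ρ⁻¹ := lt_min one_pos (inv_pos.2 hρ)
  refine hG.edge_eq_of_interior (t := min 1 ρ⁻¹ / 2) (by linarith)
    (by linarith [min_le_left 1 ρ⁻¹]) ?_
  refine (G.mem_segment_iff y _).2 ⟨min 1 ρ⁻¹ / 2 * ρ, by positivity, ?_, ?_⟩
  · have := mul_le_mul_of_nonneg_right (min_le_right 1 ρ⁻¹) hρ.le
    rw [inv_mul_cancel₀ hρ.ne'] at this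
    linarith
  · rw [hd, h]
    push_cast
    ring

section Rotation

variable [Finite V]

instance : Finite G.Dart :=
  Finite.of_injective (fun y : G.Dart => y.toProd) SimpleGraph.Dart.toProd_injective

@[simp] theorem nextCW_fst (x : G.Dart) : (G.nextCW x).fst = x.fst :=
  (G.exists_min_dart x fun y => cwAngle (G.dir x) (G.dir y)).choose_spec.1

theorem cwAngle_nextCW_le {x y : G.Dart} (h : y.fst = x.fst) :
    cwAngle (G.dir x) (G.dir (G.nextCW x)) ≤ cwAngle (G.dir x) (G.dir y) :=
  (G.exists_min_dart x fun y => cwAngle (G.dir x) (G.dir y)).choose_spec.2 y h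

@[simp] theorem nextCCW_fst (x : G.Dart) : (G.nextCCW x).fst = x.fst :=
  (G.exists_min_dart x fun y => cwAngle (G.dir y) (G.dir x)).choose_spec.1

theorem cwAngle_nextCCW_le {x y : G.Dart} (h : y.fst = x.fst) :
    cwAngle (G.dir (G.nextCCW x)) (G.dir x) ≤ cwAngle (G.dir y) (G.dir x) :=
  (G.exists_min_dart x fun y => cwAngle (G.dir y) (G.dir x)).choose_spec.2 y h

/-- If the edge before `y` were not `x`, it would lie strictly between `x` and `y`, and by
subtraction of angles it would come after `x` sooner than `y`. -/
theorem IsPlanar.nextCCW_nextCW (hG : G.IsPlanar) (x : G.Dart) :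
    G.nextCCW (G.nextCW x) = x := by
  set y := G.nextCW x with hy
  set z := G.nextCCW y with hz
  have hyf : y.fst = x.fst := nextCW_fst x
  have hzf : z.fst = x.fst := (nextCCW_fst y).trans hyf
  have h1 : cwAngle (G.dir z) (G.dir y) ≤ cwAngle (G.dir x) (G.dir y) :=
    cwAngle_nextCCW_le hyf.symm
  rcases h1.eq_or_lt with h | h
  · obtain ⟨ρ, hρ, h⟩ :=
      exists_eq_mul_of_cwAngle_eq (dir_ne_zero z) (dir_ne_zero x) (dir_ne_zero y) h
    exact hG.dart_eq_of_dir hzf hρ h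
  · have h2 := cwAngle_sub (dir_ne_zero x) (dir_ne_zero z) (dir_ne_zero y) h
    have h3 : cwAngle (G.dir x) (G.dir y) ≤ cwAngle (G.dir x) (G.dir z) := cwAngle_nextCW_le hzf
    have := cwAngle_pos (G.dir z) (G.dir y)
    linarith

theorem IsPlanar.nextCW_nextCCW (hG : G.IsPlanar) (x : G.Dart) :
    G.nextCW (G.nextCCW x) = x := by
  have hl : Function.LeftInverse G.nextCCW G.nextCW := hG.nextCCW_nextCW
  -- On a finite set a left inverse is also a right inverse, so no second angle argument is needed.
  obtain ⟨y, rfl⟩ := (Finite.injective_iff_surjective.1 hl.injective) x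
  rw [hG.nextCCW_nextCW]

/-- The dart that follows `x` on the boundary of the face on the left of `x`. -/
noncomputable def faceNext (x : G.Dart) : G.Dart := G.nextCW x.symm

@[simp] theorem faceNext_fst (x : G.Dart) : (faceNext x).fst = x.snd := nextCW_fst _

theorem IsPlanar.faceNext_injective (hG : G.IsPlanar) :
    Function.Injective (faceNext : G.Dart → G.Dart) := by
  have hl : Function.LeftInverse G.nextCCW G.nextCW := hG.nextCCW_nextCW
  intro x y h
  exact SimpleGraph.Dart.symm_involutive.injective (hl.injective h)

end Rotation

end GeomGraph

end TwoFace

/-! ### The states of a computation -/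

namespace TwoFace

namespace Token

variable {V : Type*} {G : GeomGraph V}

/-- The side of an edge along which `t` is sent, named by the dart that has it on the left. -/
def link (t : Token G) : G.Dart :=
  match t.rule with
  | .R => t.dart
  | .L => t.dart.symm

/-- The corner that `t` leaves. -/
noncomputable def origin [Finite V] (t : Token G) : G.Dart :=
  match t.rule with
  | .R => t.dart
  | .L => G.nextCW t.dart

@[simp] theorem partner_link (t : Token G) : t.partner.link = t.link := by
  obtain ⟨_ | _, x⟩ := t <;> simp [partner, link, Rule.opp]

theorem partner_ne (t : Token G) : t.partner ≠ t := by
  obtain ⟨_ | _, x⟩ := t <;> simp [partner, Rule.opp]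

/-- A side can be traversed in two directions only, and the rule is determined by the direction. -/
theorem eq_or_eq_partner_of_link_eq {t u : Token G} (h : u.link = t.link) :
    u = t ∨ u = t.partner := by
  obtain ⟨_ | _, x⟩ := t <;> obtain ⟨_ | _, y⟩ := u <;> simp_all [partner, link, Rule.opp]
  · rw [← h, SimpleGraph.Dart.symm_symm]
  · exact SimpleGraph.Dart.symm_involutive.injective h

theorem link_R (x : G.Dart) : link ⟨.R, x⟩ = x := rfl

variable [Finite V]

@[simp] theorem partner_origin (t : Token G) : t.partner.origin = t.corner := by
  obtain ⟨_ | _, x⟩ := t <;> simp [partner, corner, origin, Rule.opp]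

theorem corner_fst (t : Token G) : t.corner.fst = t.receiver := by
  obtain ⟨_ | _, x⟩ := t <;> simp [corner, receiver]

theorem origin_R (x : G.Dart) : origin ⟨.R, x⟩ = x := rfl

/-- The tokens that leave the corner at which `t` arrives. -/
theorem pair_corner (hG : G.IsPlanar) (t : Token G) : G.pair t.corner = {t.next, t.partner} := by
  obtain ⟨_ | _, x⟩ := t
  · simp [GeomGraph.pair, corner, next, partner, Rule.opp, hG.nextCCW_nextCW]
  · exact Multiset.pair_comm _ _

end Token

namespace GeomGraph

variable {V : Type*} {G : GeomGraph V}

-- Every token leaves a unique corner, so starting a face at `κ` creates precisely the tokens with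
-- origin `κ`, once each.
open Classical in
theorem count_pair [Finite V] (hG : G.IsPlanar) (κ : G.Dart) (t : Token G) :
    (G.pair κ).count t = if t.origin = κ then 1 else 0 := by
  obtain ⟨_ | _, x⟩ := t
  · simp only [pair, Token.origin, Multiset.insert_eq_cons, Multiset.count_cons,
      Multiset.count_singleton, Token.mk.injEq, true_and, reduceCtorEq, false_and, if_false,
      zero_add]
    congr
  · have : x = G.nextCCW κ ↔ G.nextCW x = κ :=
      ⟨fun h => by rw [h, hG.nextCW_nextCCW], fun h => by rw [← h, hG.nextCCW_nextCW]⟩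
    simp only [pair, Token.origin, Multiset.insert_eq_cons, Multiset.count_cons,
      Multiset.count_singleton, Token.mk.injEq, true_and, reduceCtorEq, false_and, if_false,
      add_zero, this]
    congr

open Classical in
theorem count_sum_pair [Finite V] (hG : G.IsPlanar) (T : Finset G.Dart) (t : Token G) :
    (∑ κ ∈ T, G.pair κ).count t = if t.origin ∈ T then 1 else 0 := by
  rw [Multiset.count_sum']
  simp [count_pair hG]

open Classical in
/-- The state of a computation in terms of the set `S` of corners that have been visited: a token
waits to leave every visited corner along a side that has not been used, and every side is used at
most once. -/
structure Invariant [Fintype V] (s d : V) (E : Set G.Dart) (ms : List (Token G))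
    (c : Multiset (Token G)) (S : Set G.Dart) : Prop where
  count_eq : ∀ t, c.count t = if t.origin ∈ S ∧ t.link ∉ ms.map Token.link then 1 else 0
  nodup : (ms.map Token.link).Nodup
  origin_mem : ∀ t : Token G, t.link ∈ ms.map Token.link → t.origin ∈ S
  entry : ∀ n, n ≠ d → ∀ κ ∈ G.entryCorners s d E n, ∀ κ' ∈ G.entryCorners s d E n,
    κ ∈ S → κ' ∈ S
  source : ∀ κ ∈ G.entryCorners s d E s, κ ∈ S
  -- An upper bound for `S`: it stays inside every union of boundary walks that contains the entry
  -- corners. The equivalence is needed because tokens walk both ways.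
  sound : ∀ A : Set G.Dart, (∀ κ, G.IsEntryCorner s d E κ → κ ∈ A) →
    (∀ x, x ∈ A ↔ faceNext x ∈ A) → S ⊆ A

theorem mem_entryCorners [Fintype V] {s d : V} {E : Set G.Dart} {n : V} {κ : G.Dart} :
    κ ∈ G.entryCorners s d E n ↔ κ.fst = n ∧ G.IsEntryCorner s d E κ := by
  simp [entryCorners]

-- `T` is the set of newly visited corners. This treats both ways of passing a token on: `T` is the
-- arrival corner alone, or all entry corners at the receiver.
open Classical in
theorem Invariant.receive_of_partner_notMem [Fintype V] (hG : G.IsPlanar) {s d : V}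
    {E : Set G.Dart} {ms : List (Token G)} {c : Multiset (Token G)} {S : Set G.Dart}
    (h : Invariant s d E ms c S) {t : Token G} (ht : t ∈ c) (hp : t.partner ∉ c)
    {T : Finset G.Dart} (hT : t.corner ∈ T) (hTS : ∀ κ ∈ T, κ ∉ S)
    (hE : ∀ n, n ≠ d → ∀ κ ∈ G.entryCorners s d E n, ∀ κ' ∈ G.entryCorners s d E n,
      κ ∈ T → κ' ∈ T)
    (hA : ∀ κ ∈ T, κ = t.corner ∨ G.IsEntryCorner s d E κ) :
    Invariant s d E (ms ++ [t])
      (c.erase t + ∑ κ ∈ T.erase t.corner, G.pair κ + {t.next}) (S ∪ T) := by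
  have hc := h.count_eq t
  rw [Multiset.count_eq_one_of_mem (Multiset.nodup_iff_count_le_one.2 fun u => by
    rw [h.count_eq]; split_ifs <;> simp) ht] at hc
  have hts : t.origin ∈ S ∧ t.link ∉ ms.map Token.link := by
    by_contra hcon
    rw [if_neg hcon] at hc
    exact one_ne_zero hc
  -- Of the two tokens leaving the arrival corner only the partner is not created, since its side
  -- has just been used. Adding it back completes the pairs of all corners in `T`.
  have hsum : ∀ u, (c.erase t + ∑ κ ∈ T.erase t.corner, G.pair κ + {t.next}).count u +
      (if u = t.partner then 1 else 0) =
      (c.erase t).count u + if u.origin ∈ T then 1 else 0 := by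
    intro u
    rw [← count_sum_pair hG, ← Finset.add_sum_erase T _ hT, Token.pair_corner hG]
    simp only [Multiset.count_add, Multiset.count_singleton, Multiset.insert_eq_cons,
      Multiset.count_cons]
    omega
  have hmem : ∀ u : Token G, u.link ∈ (ms ++ [t]).map Token.link ↔
      u.link ∈ ms.map Token.link ∨ u.link = t.link := by
    intro u
    rw [List.map_append, List.mem_append]
    simp
  refine ⟨fun u => ?_, ?_, fun u hu => ?_, fun n hn κ hκ κ' hκ' hm => ?_, fun κ hκ =>
    Or.inl (h.source κ hκ), fun A h1 h2 => ?_⟩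
  · have hu := hsum u
    simp only [hmem]
    by_cases hl : u.link = t.link
    · rw [if_neg (by simp [hl])]
      rcases Token.eq_or_eq_partner_of_link_eq hl with rfl | rfl
      · rw [if_neg u.partner_ne.symm, if_neg fun hm => hTS _ hm hts.1,
          Multiset.count_erase_self, h.count_eq, ← hc] at hu
        omega
      · rw [if_pos rfl, if_pos (by simpa using hT), Multiset.count_erase_of_ne t.partner_ne,
          Multiset.count_eq_zero_of_notMem hp] at hu
        omega
    · have hut : u ≠ t := fun h => hl (h ▸ rfl)
      have hup : u ≠ t.partner := fun h => hl (h ▸ t.partner_link)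
      rw [if_neg hup, Multiset.count_erase_of_ne hut, h.count_eq, add_zero] at hu
      rw [hu]
      have h3 : u.origin ∈ T → u.link ∉ ms.map Token.link := fun h1 h2 =>
        hTS _ h1 (h.origin_mem u h2)
      have h4 := hTS u.origin
      by_cases h5 : u.origin ∈ T <;> by_cases h6 : u.origin ∈ S <;>
        by_cases h7 : u.link ∈ ms.map Token.link <;> simp_all
  · rw [List.map_append]
    refine List.nodup_append.2 ⟨h.nodup, by simp, ?_⟩
    intro a ha b hb hab
    simp only [List.map_cons, List.map_nil, List.mem_singleton] at hb
    subst hab hb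
    exact hts.2 ha
  · rw [hmem] at hu
    rcases hu with hu | hu
    · exact Or.inl (h.origin_mem u hu)
    · rcases Token.eq_or_eq_partner_of_link_eq hu with rfl | rfl
      · exact Or.inl hts.1
      · exact Or.inr (by simpa using hT)
  · rcases hm with hm | hm
    · exact Or.inl (h.entry n hn κ hκ κ' hκ' hm)
    · exact Or.inr (hE n hn κ hκ κ' hκ' hm)
  · have hS := h.sound A h1 h2
    refine Set.union_subset hS fun κ hκ => ?_
    -- The arrival corner is the successor of the origin for an `R` token and its predecessor for an
    -- `L` token.
    rcases hA κ hκ with rfl | hκ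
    · have ho : t.origin ∈ A := hS hts.1
      obtain ⟨_ | _, x⟩ := t
      · exact (h2 x).1 ho
      · refine (h2 x.symm).2 ?_
        simpa [faceNext, Token.origin] using ho
    · exact h1 κ hκ

-- When two tokens meet, both directions of one side disappear and `S` is unchanged. Otherwise the
-- arrival corner is new, and `S` grows by the corners started there.
open Classical in
theorem Computation.exists_invariant [Fintype V] (hG : G.IsPlanar) {s d : V} {E : Set G.Dart}
    {ms : List (Token G)} {c : Multiset (Token G)} (h : G.Computation s d E ms c) :
    ∃ S, Invariant s d E ms c S := by
  induction h with
  | start =>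
    refine ⟨G.entryCorners s d E s, fun t => ?_, by simp, by simp, ?_, by simp, ?_⟩
    · simp [init, count_sum_pair hG]
    · intro n hn κ hκ κ' hκ' hm
      have h1 := (mem_entryCorners.1 (Finset.mem_coe.1 hm)).1
      rw [(mem_entryCorners.1 hκ).1] at h1
      exact h1 ▸ hκ'
    · intro A h1 h2 κ hκ
      exact h1 κ (mem_entryCorners.1 (Finset.mem_coe.1 hκ)).2
  | step ms c t _ ht ih =>
    obtain ⟨S, h⟩ := ih
    have hnd : c.Nodup := Multiset.nodup_iff_count_le_one.2 fun u => by
      rw [h.count_eq]; split_ifs <;> simp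
    have hmem : ∀ u, u ∈ c → u.origin ∈ S ∧ u.link ∉ ms.map Token.link := by
      intro u hu
      have hc := h.count_eq u
      rw [Multiset.count_eq_one_of_mem hnd hu] at hc
      by_contra hcon
      rw [if_neg hcon] at hc
      exact one_ne_zero hc
    have hpm : t.partner ∈ c.erase t ↔ t.partner ∈ c := Multiset.mem_erase_of_ne t.partner_ne
    unfold receive
    by_cases hp : t.partner ∈ c
    · rw [if_pos (hpm.2 hp)]
      refine ⟨S, fun u => ?_, ?_, fun u hu => ?_, h.entry, h.source, h.sound⟩
      · simp only [List.map_append, List.mem_append, List.map_cons, List.map_nil,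
          List.mem_singleton]
        by_cases hl : u.link = t.link
        · rw [if_neg (by simp [hl])]
          rcases Token.eq_or_eq_partner_of_link_eq hl with rfl | rfl
          · rw [Multiset.count_erase_of_ne u.partner_ne.symm, Multiset.count_erase_self,
              Multiset.count_eq_one_of_mem hnd ht]
          · rw [Multiset.count_erase_self, Multiset.count_erase_of_ne t.partner_ne,
              Multiset.count_eq_one_of_mem hnd hp]
        · have hut : u ≠ t := fun h => hl (h ▸ rfl)
          have hup : u ≠ t.partner := fun h => hl (h ▸ t.partner_link)
          rw [Multiset.count_erase_of_ne hup, Multiset.count_erase_of_ne hut, h.count_eq]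
          simp [hl]
      · rw [List.map_append]
        refine List.nodup_append.2 ⟨h.nodup, by simp, ?_⟩
        intro a ha b hb hab
        simp only [List.map_cons, List.map_nil, List.mem_singleton] at hb
        subst hab hb
        exact (hmem t ht).2 ha
      · rw [List.map_append, List.mem_append] at hu
        rcases hu with hu | hu
        · exact h.origin_mem u hu
        · simp only [List.map_cons, List.map_nil, List.mem_singleton] at hu
          rcases Token.eq_or_eq_partner_of_link_eq hu with rfl | rfl
          · exact (hmem _ ht).1
          · exact (hmem _ hp).1
    · rw [if_neg (fun hc => hp (hpm.1 hc))]
      -- The side of `t` was unused until now; had the arrival corner been visited, the partner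
      -- would still be waiting there.
      have hcS : t.corner ∉ S := by
        intro hc
        have := h.count_eq t.partner
        rw [Multiset.count_eq_zero_of_notMem hp, if_pos] at this
        · exact zero_ne_one this
        · exact ⟨by simpa using hc, by simpa using (hmem t ht).2⟩
      split_ifs with hr
      · refine ⟨_, h.receive_of_partner_notMem hG ht hp hr.2 ?_ ?_ ?_⟩
        · exact fun κ hκ hκS => hcS (h.entry _ hr.1 κ hκ _ hr.2 hκS)
        · intro n hn κ hκ κ' hκ' hm
          have h1 := (mem_entryCorners.1 hm).1
          rw [(mem_entryCorners.1 hκ).1] at h1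
          exact h1 ▸ hκ'
        · exact fun κ hκ => Or.inr (mem_entryCorners.1 hκ).2
      · have := h.receive_of_partner_notMem hG ht hp (T := {t.corner}) (by simp)
          (by simpa using hcS) ?_ (by simp)
        · exact ⟨_, by simpa using this⟩
        · intro n hn κ hκ κ' hκ' hm
          rw [Finset.mem_singleton] at hm
          subst hm
          have h1 : t.receiver = n := t.corner_fst.symm.trans (mem_entryCorners.1 hκ).1
          subst h1
          exact absurd ⟨hn, hκ⟩ hr

-- The sides used are distinct darts.
open Classical in
theorem Computation.length_le [Fintype V] (hG : G.IsPlanar) {s d : V} {E : Set G.Dart}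
    {ms : List (Token G)} {c : Multiset (Token G)} (h : G.Computation s d E ms c) :
    ms.length ≤ 2 * Nat.card G.graph.edgeSet := by
  obtain ⟨S, hS⟩ := h.exists_invariant hG
  have h1 := hS.nodup.length_le_card
  rw [List.length_map, SimpleGraph.dart_card_eq_twice_card_edges] at h1
  rwa [Nat.card_eq_fintype_card, ← SimpleGraph.edgeFinset_card]

/-- At the end of a complete computation the visited corners make up whole boundary walks, and
their number is the number of messages. -/
theorem Computation.exists_visited [Fintype V] (hG : G.IsPlanar) {s d : V} {E : Set G.Dart}
    {ms : List (Token G)} (h : G.Computation s d E ms 0) :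
    ∃ S : Set G.Dart, ms.length = S.ncard ∧ (∀ x, x ∈ S ↔ faceNext x ∈ S) ∧
      (∀ n, n ≠ d → ∀ κ ∈ G.entryCorners s d E n, ∀ κ' ∈ G.entryCorners s d E n,
        κ ∈ S → κ' ∈ S) ∧
      (∀ κ ∈ G.entryCorners s d E s, κ ∈ S) ∧
      ∀ A : Set G.Dart, (∀ κ, G.IsEntryCorner s d E κ → κ ∈ A) →
        (∀ x, x ∈ A ↔ faceNext x ∈ A) → S ⊆ A := by
  classical
  obtain ⟨S, hS⟩ := h.exists_invariant hG
  -- With no token waiting, every side leaving a visited corner has been used. For `R` tokens this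
  -- identifies `S` with the used sides; comparing a token with its partner gives closure under
  -- `faceNext`.
  have hmem : ∀ t : Token G, t.origin ∈ S ↔ t.link ∈ ms.map Token.link := by
    refine fun t => ⟨fun ht => ?_, hS.origin_mem t⟩
    by_contra hl
    have := hS.count_eq t
    rw [if_pos ⟨ht, hl⟩] at this
    simp at this
  refine ⟨S, ?_, fun x => ?_, hS.entry, hS.source, hS.sound⟩
  · have : S = ((ms.map Token.link).toFinset : Set G.Dart) := by
      ext x
      simpa [Token.origin_R, Token.link_R] using hmem ⟨.R, x⟩
    rw [this, Set.ncard_coe_finset, List.toFinset_card_of_nodup hS.nodup, List.length_map]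
  · have h1 := hmem ⟨.R, x⟩
    have h2 := hmem (Token.partner ⟨.R, x⟩)
    rw [Token.partner_link, Token.partner_origin] at h2
    exact h1.trans h2.symm

end GeomGraph

theorem IsCausalChain.length_le {V : Type*} {G : GeomGraph V} {ms : List (Token G)}
    {l : List (Fin ms.length)} (h : IsCausalChain ms l) : l.length ≤ ms.length := by
  have h1 : l.IsChain (· < ·) := List.IsChain.imp (fun i j hij => by
    induction hij with
    | single h => exact h.1
    | tail _ h ih => exact ih.trans h.1) h
  have h2 : l.Nodup := (List.isChain_iff_pairwise.1 h1).imp ne_of_lt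
  simpa using h2.length_le_card

end TwoFace

/-! ### Faces beside edges and at corners -/

namespace TwoFace

namespace GeomGraph

open Filter Topology Complex

variable {V : Type*} {G : GeomGraph V}

theorem mem_drawing_iff {z : ℂ} :
    z ∈ G.drawing ↔ ∃ x : G.Dart, z ∈ segment ℝ (G.pos x.fst) (G.pos x.snd) :=
  ⟨fun ⟨a, b, h, hz⟩ => ⟨⟨(a, b), h⟩, hz⟩, fun ⟨x, hz⟩ => ⟨x.fst, x.snd, x.adj, hz⟩⟩

theorem isClosed_dart_segment (x : G.Dart) :
    IsClosed (segment ℝ (G.pos x.fst) (G.pos x.snd)) := by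
  rw [← convexHull_pair]
  exact (Set.toFinite _).isClosed_convexHull ℝ

/-- Near a point there are only edges through it. -/
theorem eventually_mem_segment_imp [Finite V] (q : ℂ) :
    ∀ᶠ z in 𝓝 q, ∀ x : G.Dart, z ∈ segment ℝ (G.pos x.fst) (G.pos x.snd) →
      q ∈ segment ℝ (G.pos x.fst) (G.pos x.snd) := by
  rw [eventually_all]
  intro x
  by_cases hq : q ∈ segment ℝ (G.pos x.fst) (G.pos x.snd)
  · exact Eventually.of_forall fun _ _ => hq
  · filter_upwards [(isClosed_dart_segment x).isOpen_compl.mem_nhds hq] with z hz hz'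
    exact absurd hz' hz

theorem isOpen_compl_drawing [Finite V] : IsOpen G.drawingᶜ := by
  rw [isOpen_iff_mem_nhds]
  intro q hq
  filter_upwards [eventually_mem_segment_imp (G := G) q] with z hz hzd
  obtain ⟨x, hx⟩ := mem_drawing_iff.1 hzd
  exact hq (mem_drawing_iff.2 ⟨x, hz x hx⟩)

theorem IsFace.subset_compl {F : Set ℂ} (h : G.IsFace F) : F ⊆ G.drawingᶜ := by
  obtain ⟨z, -, rfl⟩ := h
  exact pathComponentIn_subset

theorem IsFace.isOpen [Finite V] {F : Set ℂ} (h : G.IsFace F) : IsOpen F := by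
  obtain ⟨z, -, rfl⟩ := h
  exact isOpen_compl_drawing.pathComponentIn z

theorem IsFace.isPathConnected {F : Set ℂ} (h : G.IsFace F) : IsPathConnected F := by
  obtain ⟨z, hz, rfl⟩ := h
  exact isPathConnected_pathComponentIn hz

theorem IsFace.eq_of_mem {F F' : Set ℂ} (h : G.IsFace F) (h' : G.IsFace F') {z : ℂ} (hz : z ∈ F)
    (hz' : z ∈ F') : F = F' := by
  obtain ⟨y, -, rfl⟩ := h
  obtain ⟨y', -, rfl⟩ := h'
  exact (pathComponentIn_congr hz).symm.trans (pathComponentIn_congr hz')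

/-- A path connected set off the edges lies in a face. -/
theorem exists_isFace_of_isPathConnected {A : Set ℂ} (hA : IsPathConnected A)
    (h : A ⊆ G.drawingᶜ) : ∃ F, G.IsFace F ∧ A ⊆ F := by
  obtain ⟨z, hz⟩ := hA.nonempty
  exact ⟨_, ⟨z, h hz, rfl⟩, hA.subset_pathComponentIn hz h⟩

/-- `F` is the face on the left of `x` at the point of its edge with parameter `t`. -/
def IsLeftFaceAt (x : G.Dart) (t : ℝ) (F : Set ℂ) : Prop :=
  G.IsFace F ∧ ∃ r > 0, ∀ w : ℂ, ‖w - t‖ < r → 0 < w.im → G.pos x.fst + w * G.dir x ∈ F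

/-- In the complex coordinate `w` in which the edge of `x` is the real interval from 0 to 1, a small
upper half-disc around `t` is convex and meets no edge. -/
theorem IsPlanar.exists_isLeftFaceAt [Finite V] (hG : G.IsPlanar) (x : G.Dart) {t : ℝ}
    (h0 : 0 < t) (h1 : t < 1) : ∃ F, IsLeftFaceAt x t F := by
  obtain ⟨r, hr, hball⟩ := Metric.eventually_nhds_iff.1
    (((by fun_prop : Continuous fun w : ℂ => G.pos x.fst + w * G.dir x).tendsto (t : ℂ)).eventually
      (eventually_mem_segment_imp (G := G) (G.pos x.fst + t * G.dir x)))
  set D : Set ℂ := {w | ‖w - t‖ < r ∧ 0 < w.im} with hD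
  have hconv : Convex ℝ D := by
    have : D = Metric.ball (t : ℂ) r ∩ {w | 0 < w.im} := by
      ext w
      simp [hD, Complex.dist_eq]
    rw [this]
    exact (convex_ball _ _).inter (convex_halfSpace_im_gt 0)
  have hne : D.Nonempty := by
    refine ⟨t + (r / 2 : ℝ) * I, ?_, ?_⟩
    · simp [abs_of_pos hr, hr]
    · simp [hr]
  have hpc := (hconv.isPathConnected hne).image
    (by fun_prop : Continuous fun w : ℂ => G.pos x.fst + w * G.dir x)
  obtain ⟨F, hF, hsub⟩ := exists_isFace_of_isPathConnected (G := G) hpc (by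
    rintro _ ⟨w, hw, rfl⟩ hd
    obtain ⟨y, hy⟩ := mem_drawing_iff.1 hd
    have hq := hball (y := w) (by rw [Complex.dist_eq]; exact hw.1) y hy
    have he := hG.edge_eq_of_interior h0 h1 hq
    have hx : G.pos x.fst + w * G.dir x ∈ segment ℝ (G.pos x.fst) (G.pos x.snd) := by
      rcases (SimpleGraph.dart_edge_eq_iff x y).1 he with rfl | rfl
      · exact hy
      · rw [segment_symm]
        exact hy
    obtain ⟨σ, -, -, hσ⟩ := (mem_segment_iff x _).1 hx
    have : w = σ := mul_right_cancel₀ (dir_ne_zero x) (add_left_cancel hσ)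
    have him := hw.2
    rw [this] at him
    simp at him)
  exact ⟨F, hF, r, hr, fun w h1 h2 => hsub ⟨w, ⟨h1, h2⟩, rfl⟩⟩

theorem IsLeftFaceAt.eventually {x : G.Dart} {t : ℝ} {F : Set ℂ} (h : IsLeftFaceAt x t F) :
    ∀ᶠ t' in 𝓝 t, IsLeftFaceAt x t' F := by
  obtain ⟨hF, r, hr, h⟩ := h
  rw [Metric.eventually_nhds_iff]
  refine ⟨r / 2, by linarith, fun t' ht' => ⟨hF, r / 2, by linarith, fun w hw => h w ?_⟩⟩
  rw [Real.dist_eq] at ht'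
  have h1 : ‖((t' - t : ℝ) : ℂ)‖ < r / 2 := by rwa [norm_real]
  calc ‖w - t‖ = ‖(w - t') + ((t' - t : ℝ) : ℂ)‖ := by push_cast; ring_nf
    _ ≤ ‖w - t'‖ + ‖((t' - t : ℝ) : ℂ)‖ := norm_add_le _ _
    _ < r := by linarith

theorem IsLeftFaceAt.eventually_mem {x : G.Dart} {t : ℝ} {F : Set ℂ} (h : IsLeftFaceAt x t F) :
    ∀ᶠ ε : ℝ in 𝓝[>] 0, G.pos x.fst + (t + ε * I) * G.dir x ∈ F := by
  obtain ⟨hF, r, hr, h⟩ := h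
  filter_upwards [Ioo_mem_nhdsGT hr] with ε hε
  refine h _ ?_ (by simpa using hε.1)
  simpa [abs_of_pos hε.1] using hε.2

theorem IsLeftFaceAt.eq {x : G.Dart} {t : ℝ} {F F' : Set ℂ} (h : IsLeftFaceAt x t F)
    (h' : IsLeftFaceAt x t F') : F = F' := by
  obtain ⟨ε, h1, h2⟩ := (h.eventually_mem.and h'.eventually_mem).exists
  exact h.1.eq_of_mem h'.1 h1 h2

/-- The left face is locally constant along the open edge, which is connected. -/
theorem IsPlanar.isLeftFaceAt_iff [Finite V] (hG : G.IsPlanar) {x : G.Dart} {t t' : ℝ}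
    (h0 : 0 < t) (h1 : t < 1) (h0' : 0 < t') (h1' : t' < 1) (F : Set ℂ) :
    IsLeftFaceAt x t F ↔ IsLeftFaceAt x t' F := by
  refine (isPreconnected_Ioo (a := (0 : ℝ)) (b := 1)).induction₂
    (fun t t' => ∀ F, IsLeftFaceAt x t F ↔ IsLeftFaceAt x t' F) ?_ ?_ ?_ ⟨h0, h1⟩ ⟨h0', h1'⟩ F
  · intro t ht
    obtain ⟨F, hF⟩ := hG.exists_isLeftFaceAt x ht.1 ht.2
    filter_upwards [nhdsWithin_le_nhds hF.eventually] with t' ht' F'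
    exact ⟨fun h => hF.eq h ▸ ht', fun h => ht'.eq h ▸ hF⟩
  · exact fun a b c _ _ _ h h' F => (h F).trans (h' F)
  · exact fun a b _ _ h F => (h F).symm

theorem midpoint_add_eq (x : G.Dart) (ε : ℝ) :
    (G.pos x.fst + G.pos x.snd) / 2 + ε * (I * G.dir x) =
      G.pos x.fst + ((1 / 2 : ℝ) + ε * I) * G.dir x := by
  rw [pos_snd]
  push_cast
  ring

theorem IsPlanar.isLeftFace_iff [Finite V] (hG : G.IsPlanar) {x : G.Dart} {t : ℝ} (h0 : 0 < t)
    (h1 : t < 1) {F : Set ℂ} : G.IsLeftFace x F ↔ IsLeftFaceAt x t F := by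
  rw [hG.isLeftFaceAt_iff h0 h1 (t' := 1 / 2) (by norm_num) (by norm_num)]
  constructor
  · rintro ⟨hF, h⟩
    obtain ⟨F', hF'⟩ := hG.exists_isLeftFaceAt x (t := 1 / 2) (by norm_num) (by norm_num)
    obtain ⟨ε, h1, h2⟩ := (h.and hF'.eventually_mem).exists
    rw [midpoint_add_eq] at h1
    rwa [hF.eq_of_mem hF'.1 h1 h2]
  · intro h
    refine ⟨h.1, ?_⟩
    simpa only [midpoint_add_eq] using h.eventually_mem

theorem IsPlanar.exists_isLeftFace [Finite V] (hG : G.IsPlanar) (x : G.Dart) :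
    ∃ F, G.IsLeftFace x F := by
  obtain ⟨F, hF⟩ := hG.exists_isLeftFaceAt x (t := 1 / 2) (by norm_num) (by norm_num)
  exact ⟨F, (hG.isLeftFace_iff (by norm_num) (by norm_num)).2 hF⟩

theorem IsLeftFace.eq {x : G.Dart} {F F' : Set ℂ} (h : G.IsLeftFace x F)
    (h' : G.IsLeftFace x F') : F = F' := by
  obtain ⟨ε, h1, h2⟩ := (h.2.and h'.2).exists
  exact h.1.eq_of_mem h'.1 h1 h2

/-- The points beside the edge of `x` on the right of `x` lie in the left face of `x.symm`. -/
theorem IsPlanar.exists_right_mem [Finite V] (hG : G.IsPlanar) {x : G.Dart} {F : Set ℂ}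
    (h : G.IsLeftFace x.symm F) {t : ℝ} (h0 : 0 < t) (h1 : t < 1) :
    ∃ r > 0, ∀ w : ℂ, ‖w - t‖ < r → w.im < 0 → G.pos x.fst + w * G.dir x ∈ F := by
  obtain ⟨-, r, hr, h⟩ := (hG.isLeftFace_iff (t := 1 - t) (by linarith) (by linarith)).1 h
  refine ⟨r, hr, fun w hw hi => ?_⟩
  have hn : ‖(1 - w) - ((1 - t : ℝ) : ℂ)‖ = ‖w - t‖ := by
    rw [← norm_neg]
    congr 1
    push_cast
    ring
  have := h (1 - w) (hn.trans_lt hw) (by simpa using hi)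
  rw [dir_symm] at this
  convert this using 1
  change _ = G.pos x.snd + _
  rw [pos_snd]
  ring

theorem IsPlanar.exists_dart_of_pos_mem (hG : G.IsPlanar) {κ y : G.Dart}
    (h : G.pos κ.fst ∈ segment ℝ (G.pos y.fst) (G.pos y.snd)) :
    ∃ y' : G.Dart, y'.fst = κ.fst ∧
      segment ℝ (G.pos y'.fst) (G.pos y'.snd) = segment ℝ (G.pos y.fst) (G.pos y.snd) := by
  have hv : κ.fst ∈ s(y.fst, y.snd) := by
    by_cases he : s(κ.fst, κ.snd) = s(y.fst, y.snd)
    · rw [← he]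
      exact Sym2.mem_mk_left _ _
    · obtain ⟨v, -, hv, hz⟩ := hG κ.adj y.adj he _ ⟨left_mem_segment ℝ _ _, h⟩
      rwa [G.pos_injective hz]
  rcases Sym2.mem_iff.1 hv with h | h
  · exact ⟨y, h.symm, rfl⟩
  · exact ⟨y.symm, h.symm, segment_symm ℝ _ _⟩

/-- The sector at the corner `κ` lies in one face. -/
theorem IsPlanar.exists_sector [Finite V] (hG : G.IsPlanar) (κ : G.Dart) :
    ∃ F, G.IsFace F ∧ ∃ r > 0, ∀ ρ θ : ℝ, 0 < ρ → ρ < r → 0 < θ →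
      θ < cwAngle (G.dir (G.nextCCW κ)) (G.dir κ) →
        G.pos κ.fst + ρ * exp (θ * I) * G.dir κ ∈ F := by
  set α := cwAngle (G.dir (G.nextCCW κ)) (G.dir κ) with hα
  have hα0 : 0 < α := cwAngle_pos _ _
  have hα1 : α ≤ 2 * Real.pi := cwAngle_le _ _
  obtain ⟨r₀, hr₀, hball⟩ := Metric.eventually_nhds_iff.1
    (eventually_mem_segment_imp (G := G) (G.pos κ.fst))
  have hu : 0 < ‖G.dir κ‖ := norm_pos_iff.2 (dir_ne_zero κ)
  set r := r₀ / ‖G.dir κ‖ with hr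
  have hr0 : 0 < r := div_pos hr₀ hu
  -- The sector may be reflex, or a whole slit disc, so it is not convex; it is the image of a
  -- rectangle under polar coordinates.
  have hpc : IsPathConnected (Set.Ioo 0 r ×ˢ Set.Ioo 0 α) :=
    ((convex_Ioo 0 r).prod (convex_Ioo 0 α)).isPathConnected
      ((Set.nonempty_Ioo.2 hr0).prod (Set.nonempty_Ioo.2 hα0))
  obtain ⟨F, hF, hsub⟩ := exists_isFace_of_isPathConnected (G := G)
    (hpc.image (by fun_prop : Continuous fun p : ℝ × ℝ =>
      G.pos κ.fst + p.1 * exp (p.2 * I) * G.dir κ)) (by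
    rintro _ ⟨⟨ρ, θ⟩, ⟨⟨h1, h2⟩, h3, h4⟩, rfl⟩ hd
    simp only at h1 h2 h3 h4 hd
    obtain ⟨y, hy⟩ := mem_drawing_iff.1 hd
    have hq := hball (y := G.pos κ.fst + ρ * exp (θ * I) * G.dir κ) (by
      rw [Complex.dist_eq, add_sub_cancel_left, norm_mul, norm_mul, norm_exp_ofReal_mul_I,
        norm_real, Real.norm_of_nonneg h1.le, mul_one]
      exact (lt_div_iff₀ hu).1 h2) y hy
    obtain ⟨y', hy', hseg⟩ := hG.exists_dart_of_pos_mem hq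
    rw [← hseg] at hy
    obtain ⟨σ, hσ, -, hz⟩ := (mem_segment_iff y' _).1 hy
    rw [hy'] at hz
    have hz := add_left_cancel hz
    have hσ0 : 0 < σ := by
      refine hσ.lt_of_ne' ?_
      rintro rfl
      have : (ρ : ℂ) * exp (θ * I) * G.dir κ ≠ 0 :=
        mul_ne_zero (mul_ne_zero (by exact_mod_cast h1.ne') (exp_ne_zero _)) (dir_ne_zero κ)
      exact this (by simpa using hz)
    have hσc : (σ : ℂ) ≠ 0 := by exact_mod_cast hσ0.ne'
    -- An edge through a point of the sector would leave the node at an angle smaller than that of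
    -- the next edge counterclockwise.
    have h5 : cwAngle (G.dir y') (G.dir κ) = θ :=
      cwAngle_eq_of_eq (dir_ne_zero κ) (div_pos h1 hσ0) h3 (by linarith) (by
        push_cast
        field_simp
        linear_combination -hz)
    have h6 : α ≤ cwAngle (G.dir y') (G.dir κ) := cwAngle_nextCCW_le hy'
    linarith)
  exact ⟨F, hF, r, hr0, fun ρ θ h1 h2 h3 h4 => hsub ⟨(ρ, θ), ⟨⟨h1, h2⟩, h3, h4⟩, rfl⟩⟩

theorem eventually_norm_mul_exp_sub_lt (t : ℝ) {r : ℝ} (hr : 0 < r) (σ : ℝ) :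
    ∀ᶠ θ : ℝ in 𝓝[>] 0, ‖(t : ℂ) * exp ((σ * θ : ℝ) * I) - t‖ < r := by
  have hc : Continuous fun θ : ℝ => ‖(t : ℂ) * exp ((σ * θ : ℝ) * I) - t‖ := by fun_prop
  have := hc.tendsto 0
  simp only [mul_zero, ofReal_zero, zero_mul, exp_zero, mul_one, sub_self, norm_zero] at this
  exact nhdsWithin_le_nhds (this.eventually_lt_const hr)

theorem mul_exp_im (t θ : ℝ) : ((t : ℂ) * exp (θ * I)).im = t * Real.sin θ := by
  rw [im_ofReal_mul, exp_ofReal_mul_I_im]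

/-- The sector at the corner `κ` lies in the face on the left of `κ` and on the right of the next
edge counterclockwise. -/
theorem IsPlanar.exists_sector_isLeftFace [Finite V] (hG : G.IsPlanar) (κ : G.Dart) :
    ∃ F, G.IsLeftFace κ F ∧ G.IsLeftFace (G.nextCCW κ).symm F ∧
      ∃ r > 0, ∀ ρ θ : ℝ, 0 < ρ → ρ < r → 0 < θ →
        θ < cwAngle (G.dir (G.nextCCW κ)) (G.dir κ) →
          G.pos κ.fst + ρ * exp (θ * I) * G.dir κ ∈ F := by
  obtain ⟨F, hF, r, hr, hs⟩ := hG.exists_sector κ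
  refine ⟨F, ?_, ?_, r, hr, hs⟩
  · obtain ⟨F', hF'⟩ := hG.exists_isLeftFace κ
    obtain ⟨t, ht0, ht⟩ := exists_between (lt_min hr one_pos)
    obtain ⟨-, r', hr', h'⟩ :=
      (hG.isLeftFace_iff ht0 (ht.trans_le (min_le_right _ _))).1 hF'
    -- Turning a point of the edge near the node slightly counterclockwise gives a point both in the
    -- sector and beside the edge.
    obtain ⟨θ, h1, h2, h3⟩ := ((eventually_norm_mul_exp_sub_lt t hr' 1).and
      (Ioo_mem_nhdsGT (lt_min Real.pi_pos
        (cwAngle_pos (G.dir (G.nextCCW κ)) (G.dir κ))))).exists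
    rw [one_mul] at h1
    have h4 := hs t θ ht0 (ht.trans_le (min_le_left _ _)) h2 (h3.trans_le (min_le_right _ _))
    have h5 := h' _ h1 (by
      rw [mul_exp_im]
      exact mul_pos ht0 (Real.sin_pos_of_pos_of_lt_pi h2 (h3.trans_le (min_le_left _ _))))
    rwa [hF.eq_of_mem hF'.1 h4 h5]
  · obtain ⟨F', hF'⟩ := hG.exists_isLeftFace (G.nextCCW κ).symm
    obtain ⟨ρ₀, hρ₀, hd⟩ :=
      exists_eq_mul_exp_cwAngle (dir_ne_zero (G.nextCCW κ)) (dir_ne_zero κ)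
    obtain ⟨t, ht0, ht⟩ := exists_between (lt_min (div_pos hr hρ₀) one_pos)
    obtain ⟨r', hr', h'⟩ := hG.exists_right_mem hF' ht0 (ht.trans_le (min_le_right _ _))
    set α := cwAngle (G.dir (G.nextCCW κ)) (G.dir κ) with hα
    obtain ⟨θ, h1, h2, h3⟩ := ((eventually_norm_mul_exp_sub_lt t hr' (-1)).and
      (Ioo_mem_nhdsGT (lt_min Real.pi_pos (cwAngle_pos (G.dir (G.nextCCW κ)) (G.dir κ))))).exists
    have h4 := hs (t * ρ₀) (α - θ) (mul_pos ht0 hρ₀)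
      ((lt_div_iff₀ hρ₀).1 (ht.trans_le (min_le_left _ _)))
      (sub_pos.2 (h3.trans_le (min_le_right _ _))) (by linarith)
    have h5 := h' _ h1 (by
      rw [mul_exp_im, neg_one_mul, Real.sin_neg, mul_neg, neg_lt_zero]
      exact mul_pos ht0 (Real.sin_pos_of_pos_of_lt_pi h2 (h3.trans_le (min_le_left _ _))))
    have h6 : G.pos κ.fst + ((t * ρ₀ : ℝ) : ℂ) * exp ((α - θ : ℝ) * I) * G.dir κ =
        G.pos (G.nextCCW κ).fst + (t : ℂ) * exp ((-1 * θ : ℝ) * I) * G.dir (G.nextCCW κ) := by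
      rw [nextCCW_fst, hd]
      have : exp ((α - θ : ℝ) * I) = exp ((-1 * θ : ℝ) * I) * exp (α * I) := by
        rw [← Complex.exp_add]
        push_cast
        ring_nf
      rw [this]
      push_cast
      ring
    rw [h6] at h4
    rwa [hF.eq_of_mem hF'.1 h4 h5]

/-- A boundary walk has the same face on the left everywhere. -/
theorem IsPlanar.isLeftFace_faceNext [Finite V] (hG : G.IsPlanar) {x : G.Dart} {F : Set ℂ} :
    G.IsLeftFace (faceNext x) F ↔ G.IsLeftFace x F := by
  obtain ⟨F', h1, h2, -⟩ := hG.exists_sector_isLeftFace (faceNext x)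
  rw [faceNext, hG.nextCCW_nextCW, SimpleGraph.Dart.symm_symm] at h2
  exact ⟨fun h => h1.eq h ▸ h2, fun h => h2.eq h ▸ h1⟩

/-- If no edge leaves the source along the line, then the line starts in the sector of a source
corner. -/
theorem IsPlanar.exists_isSourceCorner [Finite V] (hG : G.IsPlanar) {s d : V} (hsd : s ≠ d)
    {x : G.Dart} (hx : x.fst = s)
    (hd : ∀ y : G.Dart, y.fst = s → ∀ ρ : ℝ, 0 < ρ → G.dir y ≠ ρ * (G.pos d - G.pos s)) :
    ∃ κ F, G.IsSourceCorner s d κ ∧ G.IsLeftFace κ F ∧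
      ∀ᶠ ε : ℝ in 𝓝[>] 0, G.pos s + ε * (G.pos d - G.pos s) ∈ F := by
  have hw : G.pos d - G.pos s ≠ 0 := sub_ne_zero.2 fun h => hsd (G.pos_injective h).symm
  set w := G.pos d - G.pos s with hw'
  obtain ⟨κ, hκ, hmin⟩ := G.exists_min_dart x fun y => cwAngle w (G.dir y)
  replace hκ : κ.fst = s := hκ.trans hx
  have hmin' : ∀ y : G.Dart, y.fst = s → cwAngle w (G.dir κ) ≤ cwAngle w (G.dir y) :=
    fun y hy => hmin y (hy.trans hx.symm)
  obtain ⟨F, hF, -, r, hr, hs⟩ := hG.exists_sector_isLeftFace κ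
  -- Otherwise the next edge counterclockwise would lie along the line, or the clockwise angle from
  -- the line to it would be smaller than the one to `κ`.
  have hlt : cwAngle w (G.dir κ) < cwAngle (G.dir (G.nextCCW κ)) (G.dir κ) := by
    by_contra! hle
    have hf : (G.nextCCW κ).fst = s := (nextCCW_fst κ).trans hκ
    rcases hle.eq_or_lt with h | h
    · obtain ⟨ρ, hρ, h⟩ :=
        exists_eq_mul_of_cwAngle_eq (dir_ne_zero _) hw (dir_ne_zero κ) h
      exact hd _ hf ρ hρ h
    · have h1 := cwAngle_sub hw (dir_ne_zero _) (dir_ne_zero κ) h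
      have h2 := hmin' _ hf
      have := cwAngle_pos (G.dir (G.nextCCW κ)) (G.dir κ)
      linarith
  obtain ⟨ρ₀, hρ₀, hw1⟩ := exists_eq_mul_exp_cwAngle hw (dir_ne_zero κ)
  have hev : ∀ᶠ ε : ℝ in 𝓝[>] 0, G.pos s + ε * w ∈ F := by
    filter_upwards [Ioo_mem_nhdsGT (div_pos hr hρ₀)] with ε hε
    have := hs (ε * ρ₀) (cwAngle w (G.dir κ)) (mul_pos hε.1 hρ₀) ((lt_div_iff₀ hρ₀).1 hε.2)
      (cwAngle_pos _ _) hlt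
    rw [hκ] at this
    convert this using 2
    conv_lhs => rw [hw1]
    push_cast
    ring
  exact ⟨κ, F, ⟨hκ, hmin', F, hF, hev⟩, hF, hev⟩

end GeomGraph

end TwoFace

/-! ### Winding of flows and the boundary of a face -/

namespace TwoFace

namespace GeomGraph

open Filter Topology Complex

variable {V : Type*} {G : GeomGraph V}

/-- Clockwise angles from a common direction subtract. -/
theorem cwAngle_sub_left {u v w : ℂ} (hu : u ≠ 0) (hv : v ≠ 0) (hw : w ≠ 0)
    (h : cwAngle u v < cwAngle u w) : cwAngle v w = cwAngle u w - cwAngle u v := by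
  obtain ⟨ρ, hρ, h1⟩ := exists_eq_mul_exp_cwAngle hu hw
  obtain ⟨σ, hσ, h2⟩ := exists_eq_mul_exp_cwAngle hu hv
  have := cwAngle_le u w
  have := cwAngle_pos u v
  refine cwAngle_eq_of_eq hw (div_pos hρ hσ) (by linarith) (by linarith) ?_
  have hσ' : (σ : ℂ) ≠ 0 := by exact_mod_cast hσ.ne'
  generalize cwAngle u w = α at h1 ⊢
  generalize cwAngle u v = β at h2 ⊢
  have : exp (α * I) = exp (((α - β : ℝ) : ℂ) * I) * exp (β * I) := by
    rw [← Complex.exp_add]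
    push_cast
    ring_nf
  rw [h2, this] at h1
  refine mul_left_cancel₀ (mul_ne_zero hσ' (exp_ne_zero (β * I))) ?_
  rw [h1]
  push_cast
  field_simp

/-- Directions with equal clockwise angles from a third one are positively proportional. -/
theorem exists_eq_mul_of_cwAngle_eq_left {u v w : ℂ} (hu : u ≠ 0) (hv : v ≠ 0) (hw : w ≠ 0)
    (h : cwAngle u v = cwAngle u w) : ∃ ρ : ℝ, 0 < ρ ∧ v = ρ * w := by
  obtain ⟨ρ, hρ, h1⟩ := exists_eq_mul_exp_cwAngle hu hw
  obtain ⟨σ, hσ, h2⟩ := exists_eq_mul_exp_cwAngle hu hv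
  refine ⟨ρ / σ, div_pos hρ hσ, ?_⟩
  have hσ' : (σ : ℂ) ≠ 0 := by exact_mod_cast hσ.ne'
  rw [h] at h2
  generalize cwAngle u w = α at h1 h2
  rw [h2] at h1
  refine mul_left_cancel₀ (mul_ne_zero hσ' (exp_ne_zero (α * I))) ?_
  rw [h1]
  push_cast
  field_simp

/-- The rotation at a node is transitive on the edges. -/
theorem IsPlanar.eq_of_nextCW_invariant [Finite V] (hG : G.IsPlanar) {β : Type*} {h : G.Dart → β}
    (hr : ∀ x, h (G.nextCW x) = h x) {x y : G.Dart} (hxy : x.fst = y.fst) : h x = h y := by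
  -- Among the darts with the value of `x`, take the one closest before `y`; its clockwise successor
  -- would be closer still unless it is `y`.
  obtain ⟨z, ⟨hz, hzx⟩, hmin⟩ := Set.exists_min_image {z : G.Dart | z.fst = y.fst ∧ h z = h x}
    (fun z => cwAngle (G.dir z) (G.dir y)) (Set.toFinite _) ⟨x, hxy, rfl⟩
  have h1 : cwAngle (G.dir z) (G.dir (G.nextCW z)) ≤ cwAngle (G.dir z) (G.dir y) :=
    cwAngle_nextCW_le hz.symm
  have hf : (G.nextCW z).fst = y.fst := (nextCW_fst z).trans hz
  rcases h1.eq_or_lt with h2 | h2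
  · obtain ⟨ρ, hρ, h3⟩ :=
      exists_eq_mul_of_cwAngle_eq_left (dir_ne_zero z) (dir_ne_zero _) (dir_ne_zero y) h2
    rw [← hG.dart_eq_of_dir hf hρ h3, hr, hzx]
  · have h3 := cwAngle_sub_left (dir_ne_zero z) (dir_ne_zero _) (dir_ne_zero y) h2
    have h4 : cwAngle (G.dir z) (G.dir y) ≤ cwAngle (G.dir (G.nextCW z)) (G.dir y) :=
      hmin _ ⟨hf, (hr z).trans hzx⟩
    have := cwAngle_pos (G.dir z) (G.dir (G.nextCW z))
    linarith

/-- Reversal followed by `faceNext` is rotation at a node, so invariance spreads around each node,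
across each edge, and along walks. -/
theorem IsPlanar.eq_of_invariant [Finite V] (hG : G.IsPlanar) (hc : G.graph.Connected)
    {β : Type*} {h : G.Dart → β} (hf : ∀ x, h (faceNext x) = h x) (hs : ∀ x, h x.symm = h x)
    (x y : G.Dart) : h x = h y := by
  have hr : ∀ x, h (G.nextCW x) = h x := fun x => by
    have := hf x.symm
    rwa [faceNext, SimpleGraph.Dart.symm_symm, hs] at this
  have key : ∀ u v : V, G.graph.Walk u v → ∀ x y : G.Dart, x.fst = u → y.fst = v → h x = h y := by
    intro u v p
    induction p with
    | nil => exact fun x y hx hy => hG.eq_of_nextCW_invariant hr (hx.trans hy.symm)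
    | @cons u w v hadj p ih =>
      intro x y hx hy
      let e : G.Dart := ⟨(u, w), hadj⟩
      rw [hG.eq_of_nextCW_invariant hr (x := x) (y := e) hx, ← hs e]
      exact ih e.symm y rfl hy
  obtain ⟨p⟩ := hc.preconnected x.fst y.fst
  exact key _ _ p x y rfl rfl

/-- The angle, in `(-π, π]`, at which the edge of `x` is seen from `z`. -/
noncomputable def edgeAngle (x : G.Dart) (z : ℂ) : ℝ :=
  arg ((G.pos x.snd - z) / (G.pos x.fst - z))

/-- Two points are seen in opposite directions only from between them, so the angle of an edge is
continuous off the edge. -/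
theorem div_mem_slitPlane_of_notMem_segment {a b z : ℂ} (h : z ∉ segment ℝ a b) :
    (b - z) / (a - z) ∈ slitPlane := by
  by_contra hs
  refine h ?_
  have haz : a - z ≠ 0 := sub_ne_zero.2 fun e => h (e ▸ left_mem_segment ℝ a b)
  rw [mem_slitPlane_iff, not_or, not_lt, not_not] at hs
  obtain ⟨hre, him⟩ := hs
  set r : ℝ := -((b - z) / (a - z)).re with hr
  have hq : (b - z) / (a - z) = ((-r : ℝ) : ℂ) := Complex.ext (by simp [hr]) (by simpa using him)
  have hr0 : 0 ≤ r := by linarith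
  have hr1 : (1 + r : ℝ) ≠ 0 := by positivity
  have hr2 : (1 + r : ℂ) ≠ 0 := by exact_mod_cast hr1
  rw [div_eq_iff haz] at hq
  push_cast at hq
  refine ⟨r / (1 + r), 1 / (1 + r), by positivity, by positivity, by field_simp; ring, ?_⟩
  simp only [real_smul]
  push_cast
  field_simp
  linear_combination hq

theorem continuousAt_edgeAngle {x : G.Dart} {z : ℂ}
    (h : z ∉ segment ℝ (G.pos x.fst) (G.pos x.snd)) : ContinuousAt (edgeAngle x) z := by
  have hne : G.pos x.fst - z ≠ 0 := sub_ne_zero.2 fun e => h (e ▸ left_mem_segment ℝ _ _)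
  have h1 : ContinuousAt (fun z : ℂ => (G.pos x.snd - z) / (G.pos x.fst - z)) z :=
    ContinuousAt.div (by fun_prop) (by fun_prop) hne
  exact (continuousAt_arg (div_mem_slitPlane_of_notMem_segment h)).comp_of_eq h1 rfl

/-- Locally the seen angle changes by the difference of a function of the two end nodes, which a
conserved flow does not see. Both sides agree modulo 2π, and continuity excludes a nonzero multiple.
-/
theorem eventually_edgeAngle_eq {x : G.Dart} {z₀ : ℂ}
    (h : z₀ ∉ segment ℝ (G.pos x.fst) (G.pos x.snd)) :
    ∀ᶠ z in 𝓝 z₀, edgeAngle x z = edgeAngle x z₀ +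
      (arg ((G.pos x.snd - z) / (G.pos x.snd - z₀)) -
        arg ((G.pos x.fst - z) / (G.pos x.fst - z₀))) := by
  have ha : G.pos x.fst - z₀ ≠ 0 := sub_ne_zero.2 fun e => h (e ▸ left_mem_segment ℝ _ _)
  have hb : G.pos x.snd - z₀ ≠ 0 := sub_ne_zero.2 fun e => h (e ▸ right_mem_segment ℝ _ _)
  have hcont : ∀ p : ℂ, p - z₀ ≠ 0 → ContinuousAt (fun z => arg ((p - z) / (p - z₀))) z₀ := by
    intro p hp
    have h1 : ContinuousAt (fun z : ℂ => (p - z) / (p - z₀)) z₀ := by fun_prop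
    refine (continuousAt_arg (x := (p - z₀) / (p - z₀)) ?_).comp_of_eq h1 rfl
    rw [div_self hp]
    exact one_mem_slitPlane
  have hD : ContinuousAt (fun z => edgeAngle x z - edgeAngle x z₀ -
      (arg ((G.pos x.snd - z) / (G.pos x.snd - z₀)) -
        arg ((G.pos x.fst - z) / (G.pos x.fst - z₀)))) z₀ :=
    ((continuousAt_edgeAngle h).sub continuousAt_const).sub ((hcont _ hb).sub (hcont _ ha))
  have hsmall := Metric.continuousAt_iff'.1 hD (2 * Real.pi) Real.two_pi_pos
  have hane : ∀ᶠ z in 𝓝 z₀, G.pos x.fst - z ≠ 0 :=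
    (by fun_prop : ContinuousAt (fun z => G.pos x.fst - z) z₀).eventually_ne ha
  have hbne : ∀ᶠ z in 𝓝 z₀, G.pos x.snd - z ≠ 0 :=
    (by fun_prop : ContinuousAt (fun z => G.pos x.snd - z) z₀).eventually_ne hb
  filter_upwards [hsmall, hane, hbne] with z hz ha' hb'
  rw [div_self ha, div_self hb, arg_one, sub_self, sub_self, sub_zero, Real.dist_eq,
    sub_zero] at hz
  have hangle : ((edgeAngle x z : ℝ) : Real.Angle) = ((edgeAngle x z₀ +
      (arg ((G.pos x.snd - z) / (G.pos x.snd - z₀)) -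
        arg ((G.pos x.fst - z) / (G.pos x.fst - z₀))) : ℝ) : Real.Angle) := by
    rw [Real.Angle.coe_add, Real.Angle.coe_sub, edgeAngle, edgeAngle, arg_div_coe_angle hb' ha',
      arg_div_coe_angle hb ha, arg_div_coe_angle hb' hb, arg_div_coe_angle ha' ha]
    abel
  obtain ⟨k, hk⟩ := Real.Angle.angle_eq_iff_two_pi_dvd_sub.1 hangle
  have hk' : |2 * Real.pi * k| < 2 * Real.pi := by
    rw [← hk]
    convert hz using 2
    ring
  rw [abs_mul, abs_of_pos Real.two_pi_pos] at hk'
  have hk1 : |(k : ℝ)| < 1 := by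
    by_contra! hc
    have := mul_le_mul_of_nonneg_left hc Real.two_pi_pos.le
    linarith
  have hk0 : k = 0 := Int.abs_lt_one_iff.1 (by exact_mod_cast hk1)
  rw [hk0] at hk
  simp only [Int.cast_zero, mul_zero] at hk
  linarith

/-- As `ε` tends to 0 this approaches -1 with imaginary part of the sign of `ε`, so its argument
tends to π on the left of the edge and to -π on the right. -/
theorem midpoint_ratio {a b : ℂ} (hab : b - a ≠ 0) (ε : ℝ) :
    (b - ((a + b) / 2 + ε * (I * (b - a)))) / (a - ((a + b) / 2 + ε * (I * (b - a)))) =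
      ((ε ^ 2 - 1 / 4) / (1 / 4 + ε ^ 2) : ℝ) + (ε / (1 / 4 + ε ^ 2) : ℝ) * I := by
  have h1 : (1 / 4 + ε ^ 2 : ℝ) ≠ 0 := by positivity
  have h1' : (1 / 4 + ε ^ 2 : ℂ) ≠ 0 := by
    have := ofReal_ne_zero.2 h1
    push_cast at this
    exact this
  have h2 : (-(1 / 2) - ε * I : ℂ) ≠ 0 := fun h => by
    have := congrArg re h
    simp at this
  have h3 : a - ((a + b) / 2 + ε * (I * (b - a))) = (b - a) * (-(1 / 2) - ε * I) := by ring
  have h4 : b - ((a + b) / 2 + ε * (I * (b - a))) = (b - a) * (1 / 2 - ε * I) := by ring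
  rw [h3, h4, mul_div_mul_left _ _ hab, div_eq_iff h2]
  push_cast
  have h5 : ((ε ^ 2 - 1 / 4) / (1 / 4 + ε ^ 2) + ε / (1 / 4 + ε ^ 2) * I : ℂ) =
      (ε ^ 2 - 1 / 4 + ε * I) / (1 / 4 + ε ^ 2) := by ring
  rw [h5, div_mul_eq_mul_div, eq_div_iff h1']
  linear_combination (ε ^ 2 : ℂ) * I_sq

theorem tendsto_midpoint_ratio :
    Tendsto (fun ε : ℝ => (((ε ^ 2 - 1 / 4) / (1 / 4 + ε ^ 2) : ℝ) : ℂ) +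
      (ε / (1 / 4 + ε ^ 2) : ℝ) * I) (𝓝 0) (𝓝 (-1)) := by
  have hne : ∀ ε : ℝ, (1 / 4 + ε ^ 2 : ℝ) ≠ 0 := fun ε => by positivity
  have h1 : Continuous fun ε : ℝ => (ε ^ 2 - 1 / 4) / (1 / 4 + ε ^ 2) :=
    Continuous.div (by fun_prop) (by fun_prop) hne
  have h2 : Continuous fun ε : ℝ => ε / (1 / 4 + ε ^ 2) :=
    Continuous.div (by fun_prop) (by fun_prop) hne
  have h3 : Continuous fun ε : ℝ => (((ε ^ 2 - 1 / 4) / (1 / 4 + ε ^ 2) : ℝ) : ℂ) +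
      (ε / (1 / 4 + ε ^ 2) : ℝ) * I := by fun_prop
  have := h3.tendsto 0
  convert this using 2
  norm_num

theorem tendsto_edgeAngle_left (x : G.Dart) :
    Tendsto (fun ε : ℝ => edgeAngle x ((G.pos x.fst + G.pos x.snd) / 2 + ε * (I * G.dir x)))
      (𝓝[>] 0) (𝓝 Real.pi) := by
  refine (tendsto_arg_nhdsWithin_im_nonneg_of_re_neg_of_im_zero (z := -1) (by simp)
    (by simp)).comp (tendsto_nhdsWithin_iff.2 ⟨?_, ?_⟩)
  · simp only [dir, midpoint_ratio (dir_ne_zero x)]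
    exact tendsto_midpoint_ratio.mono_left nhdsWithin_le_nhds
  · filter_upwards [self_mem_nhdsWithin] with ε hε
    simp only [dir, midpoint_ratio (dir_ne_zero x)]
    have : (0 : ℝ) < ε := hε
    have h : 0 ≤ ε / (1 / 4 + ε ^ 2) := by positivity
    change 0 ≤ Complex.im _
    rwa [add_im, ofReal_im, mul_I_im, ofReal_re, zero_add]

theorem tendsto_edgeAngle_right (x : G.Dart) :
    Tendsto (fun ε : ℝ => edgeAngle x ((G.pos x.fst + G.pos x.snd) / 2 - ε * (I * G.dir x)))
      (𝓝[>] 0) (𝓝 (-Real.pi)) := by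
  have hneg : ∀ ε : ℝ, (G.pos x.fst + G.pos x.snd) / 2 - ε * (I * G.dir x) =
      (G.pos x.fst + G.pos x.snd) / 2 + (-ε : ℝ) * (I * G.dir x) := fun ε => by
    push_cast
    ring
  simp only [hneg]
  refine (tendsto_arg_nhdsWithin_im_neg_of_re_neg_of_im_zero (z := -1) (by simp)
    (by simp)).comp (tendsto_nhdsWithin_iff.2 ⟨?_, ?_⟩)
  · simp only [dir, midpoint_ratio (dir_ne_zero x)]
    refine (tendsto_midpoint_ratio.comp ?_).mono_left nhdsWithin_le_nhds
    simpa using (continuous_neg (G := ℝ)).tendsto 0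
  · filter_upwards [self_mem_nhdsWithin] with ε hε
    simp only [dir, midpoint_ratio (dir_ne_zero x)]
    have : (0 : ℝ) < ε := hε
    have h : -ε / (1 / 4 + (-ε) ^ 2) < 0 := div_neg_of_neg_of_pos (by linarith) (by positivity)
    change Complex.im _ < 0
    rwa [add_im, ofReal_im, mul_I_im, ofReal_re, zero_add]

/-- A real flow on the darts that is conserved at every node. -/
def IsCycle [Fintype G.Dart] (g : G.Dart → ℝ) : Prop :=
  ∀ θ : V → ℝ, ∑ x, g x * (θ x.snd - θ x.fst) = 0

/-- The total angle swept around `z` by a flow on the darts. -/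
noncomputable def wind [Fintype G.Dart] (g : G.Dart → ℝ) (z : ℂ) : ℝ :=
  ∑ x, g x * edgeAngle x z

theorem IsCycle.wind_eq_of_mem_face [Finite V] [Fintype G.Dart] {g : G.Dart → ℝ} (hg : IsCycle g)
    {F : Set ℂ} (hF : G.IsFace F) {z z' : ℂ} (hz : z ∈ F) (hz' : z' ∈ F) :
    wind g z = wind g z' := by
  refine hF.isPathConnected.isConnected.isPreconnected.induction₂
    (fun z z' => wind g z = wind g z') (fun z₀ hz₀ => ?_) (fun _ _ _ _ _ _ => Eq.trans)
    (fun _ _ _ _ => Eq.symm) hz hz'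
  have hd : ∀ x : G.Dart, z₀ ∉ segment ℝ (G.pos x.fst) (G.pos x.snd) := fun x hx =>
    hF.subset_compl hz₀ (mem_drawing_iff.2 ⟨x, hx⟩)
  filter_upwards [nhdsWithin_le_nhds
    (eventually_all.2 fun x : G.Dart => eventually_edgeAngle_eq (hd x))] with z hz
  have h0 := hg fun v => arg ((G.pos v - z) / (G.pos v - z₀))
  simp only [wind, hz, mul_add, Finset.sum_add_distrib, h0, add_zero]

/-- The winding of a flow jumps across an edge by the net flow along it. -/
theorem IsCycle.wind_sub_wind [Finite V] [Fintype G.Dart] (hG : G.IsPlanar) {g : G.Dart → ℝ}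
    (hg : IsCycle g) {x : G.Dart} {F F' : Set ℂ} (hF : G.IsLeftFace x F)
    (hF' : G.IsLeftFace x.symm F') {z z' : ℂ} (hz : z ∈ F) (hz' : z' ∈ F') :
    wind g z - wind g z' = 2 * Real.pi * (g x - g x.symm) := by
  classical
  set m := (G.pos x.fst + G.pos x.snd) / 2 with hm
  have h2 : ∀ᶠ ε : ℝ in 𝓝[>] 0, m - ε * (I * G.dir x) ∈ F' := by
    refine hF'.2.mono fun ε hε => ?_
    rw [dir_symm] at hε
    convert hε using 1
    change _ = (G.pos x.snd + G.pos x.fst) / 2 + _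
    rw [hm]
    ring
  have hconst : Tendsto (fun ε : ℝ => wind g (m + ε * (I * G.dir x)) -
      wind g (m - ε * (I * G.dir x))) (𝓝[>] 0) (𝓝 (wind g z - wind g z')) := by
    refine tendsto_const_nhds.congr' ?_
    filter_upwards [hF.2, h2] with ε h1 h2
    rw [hg.wind_eq_of_mem_face hF.1 hz h1, hg.wind_eq_of_mem_face hF'.1 hz' h2]
  -- Only the two darts of the crossed edge contribute a jump; the angles of all other edges are
  -- continuous at the midpoint.
  have hlim : Tendsto (fun ε : ℝ => wind g (m + ε * (I * G.dir x)) -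
      wind g (m - ε * (I * G.dir x))) (𝓝[>] 0)
      (𝓝 (∑ y, g y * ((if y = x then 2 * Real.pi else 0) -
        if y = x.symm then 2 * Real.pi else 0))) := by
    simp only [wind, ← Finset.sum_sub_distrib, ← mul_sub]
    refine tendsto_finsetSum _ fun y _ => Tendsto.const_mul _ ?_
    by_cases hyx : y = x
    · subst hyx
      rw [if_pos rfl, if_neg (fun h => y.adj.ne (congrArg (·.fst) h))]
      convert (tendsto_edgeAngle_left y).sub (tendsto_edgeAngle_right y) using 2
      ring
    by_cases hys : y = x.symm
    · subst hys
      rw [if_neg hyx, if_pos rfl]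
      have h := (tendsto_edgeAngle_right x.symm).sub (tendsto_edgeAngle_left x.symm)
      have hm' : (G.pos x.symm.fst + G.pos x.symm.snd) / 2 = m := by
        change (G.pos x.snd + G.pos x.fst) / 2 = m
        rw [hm, add_comm]
      simp only [hm', dir_symm, mul_neg, sub_neg_eq_add, ← sub_eq_add_neg] at h
      convert h using 2
      ring
    · rw [if_neg hyx, if_neg hys, sub_zero]
      have hmy : m ∉ segment ℝ (G.pos y.fst) (G.pos y.snd) := by
        intro hmem
        have hm2 : m = G.pos x.fst + ((1 / 2 : ℝ) : ℂ) * G.dir x := by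
          rw [hm, pos_snd]
          push_cast
          ring
        rw [hm2] at hmem
        have he := hG.edge_eq_of_interior (by norm_num) (by norm_num) hmem
        rcases (SimpleGraph.dart_edge_eq_iff x y).1 he with h | h
        · exact hyx h.symm
        · exact hys (by rw [h, SimpleGraph.Dart.symm_symm])
      have hca := (continuousAt_edgeAngle hmy).tendsto
      have ht1 : Tendsto (fun ε : ℝ => m + ε * (I * G.dir x)) (𝓝[>] 0) (𝓝 m) := by
        have := (by fun_prop : Continuous fun ε : ℝ => m + ε * (I * G.dir x)).tendsto 0
        simp only [ofReal_zero, zero_mul, add_zero] at this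
        exact this.mono_left nhdsWithin_le_nhds
      have ht2 : Tendsto (fun ε : ℝ => m - ε * (I * G.dir x)) (𝓝[>] 0) (𝓝 m) := by
        have := (by fun_prop : Continuous fun ε : ℝ => m - ε * (I * G.dir x)).tendsto 0
        simp only [ofReal_zero, zero_mul, sub_zero] at this
        exact this.mono_left nhdsWithin_le_nhds
      simpa using (hca.comp ht1).sub (hca.comp ht2)
  rw [tendsto_nhds_unique hconst hlim]
  simp only [mul_sub, Finset.sum_sub_distrib, mul_ite, mul_zero, Finset.sum_ite_eq',
    Finset.mem_univ, if_true]
  ring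

/-- A conserved flow is, up to a symmetric function, a function of the face on the left. -/
theorem IsCycle.exists_potential [Finite V] [Fintype G.Dart] (hG : G.IsPlanar) {g : G.Dart → ℝ}
    (hg : IsCycle g) : ∃ w : G.Dart → ℝ,
      (∀ x y F, G.IsLeftFace x F → G.IsLeftFace y F → w x = w y) ∧
        ∀ x, w x - w x.symm = g x - g x.symm := by
  choose F hF using hG.exists_isLeftFace
  have hne : ∀ x, ∃ z, z ∈ F x := fun x => (hF x).1.isPathConnected.nonempty
  choose z hz using hne
  refine ⟨fun x => wind g (z x) / (2 * Real.pi), fun x y F' hx hy => ?_, fun x => ?_⟩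
  · have hxy : F x = F y := ((hF x).eq hx).trans (hy.eq (hF y))
    simp only
    rw [hg.wind_eq_of_mem_face (hF y).1 (hxy ▸ hz x) (hz y)]
  · rw [← sub_div, hg.wind_sub_wind hG (hF x) (hF x.symm) (hz x) (hz x.symm)]
    field_simp

/-- Flow entering a node along `x` leaves it along `faceNext x`, and `faceNext` is a bijection. -/
theorem IsPlanar.isCycle_of_invariant [Finite V] [Fintype G.Dart] (hG : G.IsPlanar)
    {g : G.Dart → ℝ} (h : ∀ x, g (faceNext x) = g x) : IsCycle g := by
  intro θ
  simp only [mul_sub, Finset.sum_sub_distrib]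
  rw [sub_eq_zero]
  refine Fintype.sum_bijective faceNext (Finite.injective_iff_bijective.1 hG.faceNext_injective)
    _ _ fun x => ?_
  rw [h, faceNext_fst]

/-- In a connected graph, the boundary of a face is a single boundary walk. -/
theorem IsPlanar.mem_iff_of_isLeftFace [Finite V] (hG : G.IsPlanar) (hc : G.graph.Connected)
    {S : Set G.Dart} (hS : ∀ x, x ∈ S ↔ faceNext x ∈ S) {x y : G.Dart} {F : Set ℂ}
    (hx : G.IsLeftFace x F) (hy : G.IsLeftFace y F) : x ∈ S ↔ y ∈ S := by
  classical
  have := Fintype.ofFinite G.Dart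
  set g : G.Dart → ℝ := S.indicator 1 with hgdef
  have hg : ∀ x, g (faceNext x) = g x := fun x => by
    by_cases h : x ∈ S
    · simp [hgdef, h, (hS x).1 h]
    · simp [hgdef, h, (hS x).not.1 h]
  obtain ⟨w, hw, hjump⟩ := (hG.isCycle_of_invariant hg).exists_potential hG
  -- The indicator minus its potential is invariant under both `faceNext` and reversal, hence
  -- constant; so the indicator depends on the left face only.
  have hconst := hG.eq_of_invariant hc (h := fun x => g x - w x)
    (fun x => by
      obtain ⟨F, hF⟩ := hG.exists_isLeftFace x
      rw [hg, hw _ _ F (hG.isLeftFace_faceNext.2 hF) hF])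
    (fun x => by linarith [hjump x]) x y
  rw [hw x y F hx hy] at hconst
  have hgxy : g x = g y := by linarith
  have hmem : ∀ x, x ∈ S ↔ g x = 1 := fun x => by
    by_cases h : x ∈ S <;> simp [hgdef, h]
  rw [hmem, hmem, hgxy]

end GeomGraph

end TwoFace

/-! ### The number of edges -/

namespace TwoFace

namespace GeomGraph

variable {V : Type*} {G : GeomGraph V}

/-- The permutation of the darts along the boundary walks. -/
noncomputable def IsPlanar.facePerm [Finite V] (hG : G.IsPlanar) : Equiv.Perm G.Dart :=
  Equiv.ofBijective faceNext (Finite.injective_iff_bijective.1 hG.faceNext_injective)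

theorem IsPlanar.facePerm_apply [Finite V] (hG : G.IsPlanar) (x : G.Dart) :
    hG.facePerm x = faceNext x := rfl

/-- The boundary walks. -/
abbrev IsPlanar.Orbit [Finite V] (hG : G.IsPlanar) : Type _ :=
  Quotient (Equiv.Perm.SameCycle.setoid hG.facePerm)

theorem IsPlanar.eq_of_sameCycle [Finite V] (hG : G.IsPlanar) {β : Type*} {w : G.Dart → β}
    (hw : ∀ x, w (faceNext x) = w x) {x y : G.Dart} (h : hG.facePerm.SameCycle x y) :
    w x = w y := by
  obtain ⟨n, rfl⟩ := h.exists_nat_pow_eq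
  clear h
  induction n with
  | zero => rfl
  | succ n ih => rw [pow_succ', Equiv.Perm.mul_apply, hG.facePerm_apply, hw, ← ih]

/-- A boundary walk of length two exists only if the graph has a single edge. -/
theorem IsPlanar.eq_or_eq_symm_of_faceNext_faceNext [Finite V] (hG : G.IsPlanar)
    (hc : G.graph.Connected) {x : G.Dart} (h : faceNext (faceNext x) = x) (y : G.Dart) :
    y = x ∨ y = x.symm := by
  have h1 : faceNext x = x.symm := by
    refine SimpleGraph.Dart.ext _ _ (Prod.ext (faceNext_fst x) ?_)
    have := congrArg (·.fst) h
    rwa [faceNext_fst] at this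
  have h2 : faceNext x.symm = x := by rw [← h1, h]
  -- `faceNext` and reversal both swap `x` and `x.symm`, so membership in this pair is an invariant.
  have := hG.eq_of_invariant hc (h := fun z => z = x ∨ z = x.symm) (fun z => ?_) (fun z => ?_) x y
  · exact this.mp (Or.inl rfl)
  · have h3 : faceNext z = x ↔ z = x.symm := by
      conv_lhs => rw [← h2]
      exact hG.faceNext_injective.eq_iff
    have h4 : faceNext z = x.symm ↔ z = x := by
      rw [← h1]
      exact hG.faceNext_injective.eq_iff
    simp only [h3, h4, or_comm]
  · have h3 : z.symm = x ↔ z = x.symm :=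
      ⟨fun h => by rw [← h, SimpleGraph.Dart.symm_symm], fun h => by
        rw [h, SimpleGraph.Dart.symm_symm]⟩
    have h4 : z.symm = x.symm ↔ z = x := SimpleGraph.Dart.symm_involutive.injective.eq_iff
    simp only [h3, h4, or_comm]

theorem IsPlanar.three_mul_card_orbit_le [Finite V] (hG : G.IsPlanar)
    (h : ∀ x : G.Dart, faceNext (faceNext x) ≠ x) :
    3 * Nat.card hG.Orbit ≤ Nat.card G.Dart := by
  classical
  have := Fintype.ofFinite G.Dart
  have := Fintype.ofFinite hG.Orbit
  rw [Nat.card_eq_fintype_card, Nat.card_eq_fintype_card, ← Finset.card_univ, ← Finset.card_univ,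
    Finset.card_eq_sum_card_fiberwise (f := fun x : G.Dart => (⟦x⟧ : hG.Orbit))
      (t := Finset.univ) fun _ _ => by simp, mul_comm, ← smul_eq_mul]
  refine Finset.card_nsmul_le_sum _ _ _ fun o _ => ?_
  induction o using Quotient.inductionOn with
  | h x =>
  have h1 : ∀ x : G.Dart, faceNext x ≠ x := fun x hx =>
    x.adj.ne ((congrArg (·.fst) hx).symm.trans (faceNext_fst x))
  have h2 : ∀ x : G.Dart, (⟦faceNext x⟧ : hG.Orbit) = ⟦x⟧ := fun x =>
    Quotient.sound (Equiv.Perm.sameCycle_apply_left.2 (Equiv.Perm.SameCycle.refl _ x))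
  have h3 : ({x, faceNext x, faceNext (faceNext x)} : Finset G.Dart).card = 3 :=
    Finset.card_eq_three.2 ⟨_, _, _, (h1 x).symm, (h x).symm, (h1 _).symm, rfl⟩
  rw [← h3]
  refine Finset.card_le_card fun y hy => ?_
  simp only [Finset.mem_insert, Finset.mem_singleton] at hy
  rw [Finset.mem_filter]
  refine ⟨Finset.mem_univ _, ?_⟩
  rcases hy with rfl | rfl | rfl
  · rfl
  · exact h2 _
  · rw [h2, h2]

/-- The inequality in Euler's formula that bounds the number of edges. -/
theorem IsPlanar.card_edgeSet_le_add [Fintype V] (hG : G.IsPlanar) :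
    Nat.card G.graph.edgeSet ≤ Fintype.card V + Nat.card hG.Orbit := by
  classical
  have := Fintype.ofFinite hG.Orbit
  let edge : G.Dart → G.graph.edgeSet := fun x => ⟨x.edge, x.edge_mem⟩
  let M : ((hG.Orbit → ℝ) × (G.graph.edgeSet → ℝ)) →ₗ[ℝ] (G.Dart → ℝ) :=
    (LinearMap.funLeft ℝ ℝ fun x : G.Dart => (⟦x⟧ : hG.Orbit)).coprod (LinearMap.funLeft ℝ ℝ edge)
  let ℓ : G.Dart → Module.Dual ℝ (V → ℝ) := fun x =>
    (LinearMap.proj x.snd : (V → ℝ) →ₗ[ℝ] ℝ) - LinearMap.proj x.fst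
  let B : (G.Dart → ℝ) →ₗ[ℝ] Module.Dual ℝ (V → ℝ) :=
    ∑ x, (LinearMap.proj x : (G.Dart → ℝ) →ₗ[ℝ] ℝ).smulRight (ℓ x)
  have hB : ∀ g θ, B g θ = ∑ x, g x * (θ x.snd - θ x.fst) := fun g θ => by
    simp [B, ℓ, LinearMap.sum_apply]
  -- The kernel of `B` is the space of conserved flows, and each is a function of the boundary walk
  -- plus a function of the edge. Counting dimensions, 2|E| is at most |V| plus the number of walks
  -- plus |E|.
  have hker : LinearMap.ker B ≤ LinearMap.range M := by
    intro g hg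
    have hcyc : IsCycle g := fun θ => by rw [← hB, LinearMap.mem_ker.1 hg, LinearMap.zero_apply]
    obtain ⟨w, hw, hjump⟩ := hcyc.exists_potential hG
    have hinv : ∀ x, w (faceNext x) = w x := fun x => by
      obtain ⟨F, hF⟩ := hG.exists_isLeftFace x
      exact hw _ _ F (hG.isLeftFace_faceNext.2 hF) hF
    have hsurj : Function.Surjective edge := by
      rintro ⟨e, he⟩
      induction e using Sym2.ind with
      | _ a b => exact ⟨⟨(a, b), he⟩, rfl⟩
    refine ⟨(Quotient.lift w fun x y h => hG.eq_of_sameCycle hinv h,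
      fun e => g (Function.surjInv hsurj e) - w (Function.surjInv hsurj e)), ?_⟩
    ext x
    change w x + (g (Function.surjInv hsurj (edge x)) - w (Function.surjInv hsurj (edge x))) = g x
    have he : (Function.surjInv hsurj (edge x)).edge = x.edge :=
      congrArg Subtype.val (Function.surjInv_eq hsurj (edge x))
    rcases (SimpleGraph.dart_edge_eq_iff _ _).1 he with h | h
    · rw [h]
      ring
    · rw [h]
      linarith [hjump x]
  have h1 := LinearMap.finrank_range_add_finrank_ker B
  have h2 : Module.finrank ℝ (LinearMap.range B) ≤ Fintype.card V := by
    refine (Submodule.finrank_le _).trans ?_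
    rw [Subspace.dual_finrank_eq, Module.finrank_fintype_fun_eq_card]
  have h3 := (Submodule.finrank_mono hker).trans (LinearMap.finrank_range_le M)
  rw [Module.finrank_prod, Module.finrank_fintype_fun_eq_card,
    Module.finrank_fintype_fun_eq_card] at h3
  rw [Module.finrank_fintype_fun_eq_card, SimpleGraph.dart_card_eq_twice_card_edges,
    SimpleGraph.edgeFinset_card] at h1
  rw [Nat.card_eq_fintype_card, Nat.card_eq_fintype_card]
  omega

theorem card_dart [Fintype V] : Nat.card G.Dart = 2 * Nat.card G.graph.edgeSet := by
  classical
  rw [Nat.card_eq_fintype_card, SimpleGraph.dart_card_eq_twice_card_edges,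
    SimpleGraph.edgeFinset_card, Nat.card_eq_fintype_card]

theorem IsPlanar.card_edgeSet_le [Fintype V] (hG : G.IsPlanar) (hc : G.graph.Connected) :
    Nat.card G.graph.edgeSet ≤ 3 * Fintype.card V := by
  by_cases h : ∃ x : G.Dart, faceNext (faceNext x) = x
  · obtain ⟨x, hx⟩ := h
    have h1 : (Set.univ : Set G.Dart) ⊆ {x, x.symm} := fun y _ =>
      hG.eq_or_eq_symm_of_faceNext_faceNext hc hx y
    have h2 := (Set.ncard_le_ncard h1).trans (Set.ncard_insert_le x {x.symm})
    rw [Set.ncard_univ, card_dart, Set.ncard_singleton] at h2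
    have : 0 < Fintype.card V := Fintype.card_pos_iff.2 ⟨x.fst⟩
    omega
  · push Not at h
    have h1 := hG.three_mul_card_orbit_le h
    have h2 := hG.card_edgeSet_le_add
    rw [card_dart] at h1
    omega

end GeomGraph

end TwoFace

/-! ### The faces on the line -/

namespace TwoFace

namespace GeomGraph

open Filter Topology Complex

variable {V : Type*} {G : GeomGraph V} {s d : V}

theorem mem_line_iff {z : ℂ} :
    z ∈ G.line s d ↔ ∃ τ : ℝ, 0 < τ ∧ τ < 1 ∧ z = G.pos s + τ * (G.pos d - G.pos s) := by
  rw [line, openSegment_eq_image']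
  constructor
  · rintro ⟨τ, ⟨h0, h1⟩, rfl⟩
    exact ⟨τ, h0, h1, by simp⟩
  · rintro ⟨τ, h0, h1, rfl⟩
    exact ⟨τ, ⟨h0, h1⟩, by simp⟩

theorem ne_of_forall_notMem_line (hn : ∀ v : V, G.pos v ∉ G.line s d) : s ≠ d := by
  rintro rfl
  exact hn s (by simp [line])

/-- If the line is not contained in an edge, then all edges that meet it are transversal to it. -/
theorem dir_ne_of_mem_line (hn : ∀ v : V, G.pos v ∉ G.line s d) {τ₀ τ₁ : ℝ} (h0 : 0 < τ₀)
    (h0' : τ₀ < 1) (h1 : 0 < τ₁) (h1' : τ₁ < 1)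
    (hoff : G.pos s + τ₁ * (G.pos d - G.pos s) ∉ G.drawing) {x : G.Dart}
    (hx : G.pos s + τ₀ * (G.pos d - G.pos s) ∈ segment ℝ (G.pos x.fst) (G.pos x.snd)) (k : ℝ) :
    G.dir x ≠ k * (G.pos d - G.pos s) := by
  intro hk
  obtain ⟨t, ht0, ht1, ht⟩ := (mem_segment_iff x _).1 hx
  have hk0 : k ≠ 0 := by
    rintro rfl
    exact dir_ne_zero x (by simpa using hk)
  have ha : G.pos x.fst = G.pos s + ((τ₀ - t * k : ℝ) : ℂ) * (G.pos d - G.pos s) := by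
    rw [hk] at ht
    push_cast
    linear_combination -ht
  have hb : G.pos x.snd = G.pos s + ((τ₀ + (1 - t) * k : ℝ) : ℂ) * (G.pos d - G.pos s) := by
    rw [pos_snd, ha, hk]
    push_cast
    ring
  -- A parallel edge meeting the line has both ends outside the open segment, hence covers all of
  -- it, including the point assumed to be off the edges.
  have hna : ¬ (0 < τ₀ - t * k ∧ τ₀ - t * k < 1) := fun h =>
    hn x.fst (mem_line_iff.2 ⟨_, h.1, h.2, ha⟩)
  have hnb : ¬ (0 < τ₀ + (1 - t) * k ∧ τ₀ + (1 - t) * k < 1) := fun h =>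
    hn x.snd (mem_line_iff.2 ⟨_, h.1, h.2, hb⟩)
  have hkc : (k : ℂ) ≠ 0 := by exact_mod_cast hk0
  refine hoff (mem_drawing_iff.2 ⟨x, (mem_segment_iff x _).2
    ⟨(τ₁ - (τ₀ - t * k)) / k, ?_, ?_, ?_⟩⟩)
  · rcases hk0.lt_or_gt with h | h
    · have : t * k ≤ 0 := mul_nonpos_of_nonneg_of_nonpos ht0 h.le
      have h2 : 1 ≤ τ₀ - t * k := by
        by_contra! hc
        exact hna ⟨by linarith, hc⟩
      exact div_nonneg_of_nonpos (by linarith) h.le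
    · have : 0 ≤ t * k := mul_nonneg ht0 h.le
      have h2 : τ₀ - t * k ≤ 0 := by
        by_contra! hc
        exact hna ⟨hc, by linarith⟩
      exact div_nonneg (by linarith) h.le
  · rcases hk0.lt_or_gt with h | h
    · have : (1 - t) * k ≤ 0 := mul_nonpos_of_nonneg_of_nonpos (by linarith) h.le
      have h2 : τ₀ + (1 - t) * k ≤ 0 := by
        by_contra! hc
        exact hnb ⟨hc, by linarith⟩
      rw [div_le_one_of_neg h]
      linarith
    · have : 0 ≤ (1 - t) * k := mul_nonneg (by linarith) h.le
      have h2 : 1 ≤ τ₀ + (1 - t) * k := by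
        by_contra! hc
        exact hnb ⟨by linarith, hc⟩
      rw [div_le_one h]
      linarith
  · rw [ha, hk]
    push_cast
    field_simp
    ring

theorem div_im_ne_zero {u w : ℂ} (hu : u ≠ 0) (hw : w ≠ 0) (h : ∀ k : ℝ, u ≠ k * w) :
    (w / u).im ≠ 0 := by
  intro him
  have hq : w / u = ((w / u).re : ℂ) := Complex.ext (by simp) (by simpa using him)
  have hne : w / u ≠ 0 := div_ne_zero hw hu
  refine h (w / u).re⁻¹ ?_
  push_cast
  rw [← hq]
  field_simp

section Line

variable [Fintype V] {E S : Set G.Dart}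

/-- The two corners beside `x` at its start are `x` and `faceNext x.symm`; away from `d` they are
visited together. -/
theorem mem_iff_symm_mem_of_mem_entry
    (hS : ∀ x, x ∈ S ↔ faceNext x ∈ S)
    (hentry : ∀ n, n ≠ d → ∀ κ ∈ G.entryCorners s d E n, ∀ κ' ∈ G.entryCorners s d E n,
      κ ∈ S → κ' ∈ S) {x : G.Dart} (hx : x ∈ E) (hxd : x.fst ≠ d) : x ∈ S ↔ x.symm ∈ S := by
  have h1 : x ∈ G.entryCorners s d E x.fst :=
    mem_entryCorners.2 ⟨rfl, Or.inr ⟨x, hx, Or.inl rfl⟩⟩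
  have h2 : G.nextCW x ∈ G.entryCorners s d E x.fst :=
    mem_entryCorners.2 ⟨nextCW_fst x, Or.inr ⟨x, hx, Or.inr rfl⟩⟩
  rw [hS x.symm, faceNext, SimpleGraph.Dart.symm_symm]
  exact ⟨hentry _ hxd _ h1 _ h2, hentry _ hxd _ h2 _ h1⟩

/-- Near a point of the line, up to that point itself, either all faces on the line have been
visited or none has. -/
theorem IsPlanar.exists_eventually_visited_iff (hG : G.IsPlanar) (hc : G.graph.Connected)
    (hE : G.IsEntryChoice s d E) (hn : ∀ v : V, G.pos v ∉ G.line s d)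
    (hS : ∀ x, x ∈ S ↔ faceNext x ∈ S)
    (hentry : ∀ n, n ≠ d → ∀ κ ∈ G.entryCorners s d E n, ∀ κ' ∈ G.entryCorners s d E n,
      κ ∈ S → κ' ∈ S) {τ₁ : ℝ} (h1 : 0 < τ₁) (h1' : τ₁ < 1)
    (hoff : G.pos s + τ₁ * (G.pos d - G.pos s) ∉ G.drawing) {τ₀ : ℝ} (h0 : 0 < τ₀)
    (h0' : τ₀ < 1) :
    ∃ P : Prop, ∀ᶠ τ : ℝ in 𝓝[≠] τ₀,
      ((∀ y F, G.IsLeftFace y F → G.pos s + τ * (G.pos d - G.pos s) ∈ F → y ∈ S) ↔ P) := by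
  have hw : G.pos d - G.pos s ≠ 0 := sub_ne_zero.2 fun h =>
    ne_of_forall_notMem_line hn (G.pos_injective h).symm
  set w := G.pos d - G.pos s with hwdef
  have hcont : Continuous fun τ : ℝ => G.pos s + τ * w := by fun_prop
  by_cases hdr : G.pos s + τ₀ * w ∈ G.drawing
  swap
  · have hF : G.IsFace (pathComponentIn G.drawingᶜ (G.pos s + τ₀ * w)) := ⟨_, hdr, rfl⟩
    have hmem : G.pos s + τ₀ * w ∈ pathComponentIn G.drawingᶜ (G.pos s + τ₀ * w) :=
      mem_pathComponentIn_self hdr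
    set F := pathComponentIn G.drawingᶜ (G.pos s + τ₀ * w)
    refine ⟨∀ y, G.IsLeftFace y F → y ∈ S, ?_⟩
    filter_upwards [nhdsWithin_le_nhds ((hcont.tendsto τ₀).eventually (hF.isOpen.mem_nhds hmem))]
      with τ hτ
    refine ⟨fun h y hy => h y F hy hτ, fun h y F' hy hF' => h y ?_⟩
    rwa [hF.eq_of_mem hy.1 hτ hF']
  obtain ⟨x, hx⟩ := mem_drawing_iff.1 hdr
  have htrans := dir_ne_of_mem_line hn h0 h0' h1 h1' hoff hx
  have him := div_im_ne_zero (dir_ne_zero x) hw htrans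
  have hline : G.pos s + τ₀ * w ∈ G.line s d := mem_line_iff.2 ⟨τ₀, h0, h0', rfl⟩
  obtain ⟨t, ht0, ht1, ht⟩ := (mem_segment_iff x _).1 hx
  have ht0 : 0 < t := by
    refine ht0.lt_of_ne' ?_
    rintro rfl
    refine hn x.fst ?_
    rwa [ht, ofReal_zero, zero_mul, add_zero] at hline
  have ht1 : t < 1 := by
    refine ht1.lt_of_ne ?_
    rintro rfl
    refine hn x.snd ?_
    rwa [ht, ofReal_one, one_mul, ← pos_snd] at hline
  -- The destination starts no faces, so it must not be the acting entry point. An edge ending at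
  -- `d` and meeting the line elsewhere would be parallel to it.
  have hfst : x.fst ≠ d := by
    intro hd
    have h : ((τ₀ - 1 : ℝ) : ℂ) * w = t * G.dir x := by
      rw [hd] at ht
      push_cast
      linear_combination ht - hwdef
    have htc : (t : ℂ) ≠ 0 := by exact_mod_cast ht0.ne'
    refine htrans ((τ₀ - 1) / t) ?_
    push_cast at h ⊢
    field_simp
    linear_combination -h
  have hsnd : x.snd ≠ d := by
    intro hd
    have hps := pos_snd x
    have h : ((1 - τ₀ : ℝ) : ℂ) * w = ((1 - t : ℝ) : ℂ) * G.dir x := by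
      rw [hd] at hps
      push_cast
      linear_combination hps - ht + hwdef
    have htc : ((1 - t : ℝ) : ℂ) ≠ 0 := by exact_mod_cast (sub_pos.2 ht1).ne'
    refine htrans ((1 - τ₀) / (1 - t)) ?_
    push_cast at h htc ⊢
    field_simp
    linear_combination -h
  obtain ⟨F, hF⟩ := hG.exists_isLeftFace x
  obtain ⟨F', hF'⟩ := hG.exists_isLeftFace x.symm
  obtain ⟨-, r, hr, hleft⟩ := (hG.isLeftFace_iff ht0 ht1).1 hF
  obtain ⟨r', hr', hright⟩ := hG.exists_right_mem hF' ht0 ht1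
  set q := w / G.dir x with hq
  have hqu : q * G.dir x = w := div_mul_cancel₀ _ (dir_ne_zero x)
  have hpt : ∀ τ : ℝ, G.pos s + τ * w = G.pos x.fst + (t + ((τ - τ₀ : ℝ) : ℂ) * q) * G.dir x := by
    intro τ
    push_cast
    linear_combination ht - ((τ : ℂ) - τ₀) * hqu
  have hnear : ∀ᶠ τ : ℝ in 𝓝 τ₀, ‖(t + ((τ - τ₀ : ℝ) : ℂ) * q) - t‖ < min r r' := by
    have hc : Continuous fun τ : ℝ => ‖(t + ((τ - τ₀ : ℝ) : ℂ) * q) - t‖ := by fun_prop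
    have := hc.tendsto τ₀
    simp only [sub_self, ofReal_zero, zero_mul, add_zero, norm_zero] at this
    exact this.eventually_lt_const (lt_min hr hr')
  have himτ : ∀ τ : ℝ, ((t : ℂ) + ((τ - τ₀ : ℝ) : ℂ) * q).im = (τ - τ₀) * q.im := by
    intro τ
    rw [add_im, ofReal_im, zero_add, im_ofReal_mul]
  have hside : ∀ᶠ τ : ℝ in 𝓝 τ₀, (0 < (τ - τ₀) * q.im → G.pos s + τ * w ∈ F) ∧
      ((τ - τ₀) * q.im < 0 → G.pos s + τ * w ∈ F') := by
    filter_upwards [hnear] with τ hτ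
    rw [hpt, ← himτ]
    exact ⟨hleft _ (hτ.trans_le (min_le_left _ _)), hright _ (hτ.trans_le (min_le_right _ _))⟩
  have hcross : F ∈ G.crossedFaces s d ∧ F' ∈ G.crossedFaces s d := by
    have hin : ∀ᶠ τ : ℝ in 𝓝 τ₀, τ ∈ Set.Ioo (0 : ℝ) 1 := Ioo_mem_nhds h0 h0'
    obtain ⟨τ, ⟨hτs, hτi⟩, hτ⟩ :=
      (((hside.and hin).filter_mono (nhdsWithin_le_nhds (s := Set.Ioi τ₀))).and
        self_mem_nhdsWithin).exists
    obtain ⟨σ, ⟨hσs, hσi⟩, hσ⟩ :=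
      (((hside.and hin).filter_mono (nhdsWithin_le_nhds (s := Set.Iio τ₀))).and
        self_mem_nhdsWithin).exists
    have hτ' : 0 < τ - τ₀ := sub_pos.2 hτ
    have hσ' : σ - τ₀ < 0 := sub_neg.2 hσ
    have hτl : G.pos s + τ * w ∈ G.line s d := mem_line_iff.2 ⟨τ, hτi.1, hτi.2, rfl⟩
    have hσl : G.pos s + σ * w ∈ G.line s d := mem_line_iff.2 ⟨σ, hσi.1, hσi.2, rfl⟩
    rcases him.lt_or_gt with h | h
    · exact ⟨⟨hF.1, _, hσs.1 (mul_pos_of_neg_of_neg hσ' h), hσl⟩,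
        ⟨hF'.1, _, hτs.2 (mul_neg_of_pos_of_neg hτ' h), hτl⟩⟩
    · exact ⟨⟨hF.1, _, hτs.1 (mul_pos hτ' h), hτl⟩,
        ⟨hF'.1, _, hσs.2 (mul_neg_of_neg_of_pos hσ' h), hσl⟩⟩
  -- Either both sides belong to one face, whose boundary is a single walk, or the edge is an entry
  -- edge and one of its ends links the two faces.
  have hsymm : x ∈ S ↔ x.symm ∈ S := by
    by_cases hFF : F = F'
    · subst hFF
      exact hG.mem_iff_of_isLeftFace hc hS hF hF'
    · have hEe : G.IsEntryEdge s d x :=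
        ⟨⟨F, F', hFF, hF, hF', hcross.1, hcross.2⟩, _, hx, hline⟩
      rcases hE.2 x hEe with h | h
      · exact mem_iff_symm_mem_of_mem_entry hS hentry h hfst
      · have := mem_iff_symm_mem_of_mem_entry hS hentry h hsnd
        rw [SimpleGraph.Dart.symm_symm] at this
        exact this.symm
  refine ⟨x ∈ S, ?_⟩
  filter_upwards [nhdsWithin_le_nhds hside, self_mem_nhdsWithin] with τ hτ hne
  have hne' : (τ - τ₀) * q.im ≠ 0 := mul_ne_zero (sub_ne_zero.2 hne) him
  rcases hne'.lt_or_gt with h | h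
  · have hm := hτ.2 h
    rw [hsymm]
    refine ⟨fun hall => hall _ _ hF' hm, fun hxs y F₁ hy hF₁ => ?_⟩
    rw [hy.1.eq_of_mem hF'.1 hF₁ hm] at hy
    exact (hG.mem_iff_of_isLeftFace hc hS hy hF').2 hxs
  · have hm := hτ.1 h
    refine ⟨fun hall => hall _ _ hF hm, fun hxs y F₁ hy hF₁ => ?_⟩
    rw [hy.1.eq_of_mem hF.1 hF₁ hm] at hy
    exact (hG.mem_iff_of_isLeftFace hc hS hy hF).2 hxs

theorem eventually_nhdsNE_of_eventually {p : ℝ → Prop} {a : ℝ} (h : ∀ᶠ x in 𝓝[≠] a, p x) :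
    ∀ᶠ y in 𝓝 a, ∀ᶠ x in 𝓝[≠] y, p x := by
  rw [eventually_nhdsWithin_iff] at h
  filter_upwards [eventually_eventually_nhds.2 h] with y hy
  by_cases hya : y = a
  · subst hya
    exact eventually_nhdsWithin_iff.2 hy
  · exact nhdsWithin_le_nhds ((hy.and (isOpen_ne.mem_nhds hya)).mono fun x hx => hx.1 hx.2)

/-- All sides of the faces that intersect the line are visited. -/
theorem IsPlanar.mem_of_crossed (hG : G.IsPlanar) (hc : G.graph.Connected)
    (hE : G.IsEntryChoice s d E) (hn : ∀ v : V, G.pos v ∉ G.line s d)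
    (hS : ∀ x, x ∈ S ↔ faceNext x ∈ S)
    (hentry : ∀ n, n ≠ d → ∀ κ ∈ G.entryCorners s d E n, ∀ κ' ∈ G.entryCorners s d E n,
      κ ∈ S → κ' ∈ S) (hsource : ∀ κ ∈ G.entryCorners s d E s, κ ∈ S)
    {F : Set ℂ} (hF : F ∈ G.crossedFaces s d) {y : G.Dart} (hy : G.IsLeftFace y F) : y ∈ S := by
  have hsd := ne_of_forall_notMem_line hn
  obtain ⟨-, z, hzF, hzl⟩ := hF
  obtain ⟨τ₁, h1, h1', rfl⟩ := mem_line_iff.1 hzl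
  have hoff := hy.1.subset_compl hzF
  obtain ⟨x, hx⟩ : ∃ x : G.Dart, x.fst = s := by
    obtain ⟨p⟩ := hc.preconnected s d
    cases p with
    | nil => exact absurd rfl hsd
    | cons h _ => exact ⟨⟨(_, _), h⟩, rfl⟩
  obtain ⟨κ, F₀, hκ, hκF, hev⟩ := hG.exists_isSourceCorner hsd hx (by
    intro y hys ρ hρ hdir
    have hm : 0 < min 1 ρ := lt_min one_pos hρ
    refine dir_ne_of_mem_line hn (τ₀ := min 1 ρ / 2) (by linarith)
      (by linarith [min_le_left 1 ρ]) h1 h1' hoff (x := y) ?_ ρ hdir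
    refine (mem_segment_iff y _).2 ⟨min 1 ρ / 2 / ρ, by positivity, ?_, ?_⟩
    · rw [div_le_one hρ]
      linarith [min_le_right 1 ρ]
    · have hρc : (ρ : ℂ) ≠ 0 := by exact_mod_cast hρ.ne'
      rw [hys, hdir]
      push_cast
      field_simp)
  have hκS : κ ∈ S := hsource κ (mem_entryCorners.2 ⟨hκ.1, Or.inl hκ⟩)
  set P : ℝ → Prop := fun τ =>
    ∀ y F, G.IsLeftFace y F → G.pos s + τ * (G.pos d - G.pos s) ∈ F → y ∈ S with hP
  have hstart : ∃ τ ∈ Set.Ioo (0 : ℝ) 1, ∀ᶠ τ' in 𝓝[≠] τ, P τ' := by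
    obtain ⟨u, hu, hsub⟩ := mem_nhdsGT_iff_exists_Ioo_subset.1 hev
    have hu' : (0 : ℝ) < u := hu
    have hm : 0 < min 1 u := lt_min one_pos hu'
    refine ⟨min 1 u / 2, ⟨by linarith, by linarith [min_le_left 1 u]⟩, nhdsWithin_le_nhds ?_⟩
    filter_upwards [Ioo_mem_nhds (a := (0 : ℝ)) (b := u) (by linarith)
      (by linarith [min_le_right 1 u])] with τ hτ y F hy hyF
    have hyF₀ : G.pos s + τ * (G.pos d - G.pos s) ∈ F₀ := hsub hτ
    rw [hy.1.eq_of_mem hκF.1 hyF hyF₀] at hy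
    exact (hG.mem_iff_of_isLeftFace hc hS hy hκF).2 hκS
  obtain ⟨τ, hτ, hPτ⟩ := hstart
  -- Punctured neighbourhoods are used because at a point on an edge `P` holds vacuously.
  have hall := (isPreconnected_Ioo (a := (0 : ℝ)) (b := 1)).induction₂
    (fun a b => (∀ᶠ τ' in 𝓝[≠] a, P τ') ↔ ∀ᶠ τ' in 𝓝[≠] b, P τ') (fun a ha => by
      obtain ⟨Q, hQ⟩ := hG.exists_eventually_visited_iff hc hE hn hS hentry h1 h1' hoff ha.1 ha.2
      have hiff : ∀ b : ℝ, (∀ᶠ τ in 𝓝[≠] b, (P τ ↔ Q)) → ((∀ᶠ τ in 𝓝[≠] b, P τ) ↔ Q) :=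
        fun b hb => ⟨fun h => by
          obtain ⟨τ, h1, h2⟩ := (hb.and h).exists
          exact h1.1 h2, fun hq => hb.mono fun τ h => h.2 hq⟩
      filter_upwards [nhdsWithin_le_nhds (eventually_nhdsNE_of_eventually hQ)] with b hb
      exact (hiff a hQ).trans (hiff b hb).symm)
    (fun _ _ _ _ _ _ => Iff.trans) (fun _ _ _ _ => Iff.symm) hτ ⟨h1, h1'⟩
  have hcont : Continuous fun τ : ℝ => G.pos s + τ * (G.pos d - G.pos s) := by fun_prop
  obtain ⟨τ', hτ', hmem⟩ := ((hall.1 hPτ).and (nhdsWithin_le_nhds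
    ((hcont.tendsto τ₁).eventually (hy.1.isOpen.mem_nhds hzF)))).exists
  exact hτ' y F hy hmem

/-- With the clause `sound` of the invariant, this confines the visited corners to the crossed
faces. -/
theorem IsEntryCorner.exists_crossed (hG : G.IsPlanar) (hE : G.IsEntryChoice s d E) {κ : G.Dart}
    (h : G.IsEntryCorner s d E κ) : ∃ F ∈ G.crossedFaces s d, G.IsLeftFace κ F := by
  rcases h with ⟨-, -, F, hF, hev⟩ | ⟨x, hx, rfl | rfl⟩
  · obtain ⟨ε, h1, h2⟩ := (hev.and (Ioo_mem_nhdsGT (zero_lt_one (α := ℝ)))).exists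
    exact ⟨F, ⟨hF.1, _, h1, mem_line_iff.2 ⟨ε, h2.1, h2.2, rfl⟩⟩, hF⟩
  · obtain ⟨⟨F, F', -, h1, h2, h3, h4⟩, -⟩ := hE.1 _ hx
    exact ⟨F, h3, h1⟩
  · obtain ⟨⟨F, F', -, h1, h2, h3, h4⟩, -⟩ := hE.1 _ hx
    have := hG.isLeftFace_faceNext.2 h2
    rw [faceNext, SimpleGraph.Dart.symm_symm] at this
    exact ⟨F', h4, this⟩

end Line

/-- Each dart has exactly one left face, so the darts are partitioned by it; only finitely many
faces have a nonzero count. -/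
theorem IsPlanar.finsum_faceEdges [Fintype V] (hG : G.IsPlanar) (A : Set (Set ℂ)) :
    ∑ᶠ F ∈ A, G.faceEdges F = {x : G.Dart | ∃ F ∈ A, G.IsLeftFace x F}.ncard := by
  classical
  choose f hf using hG.exists_isLeftFace
  have hiff : ∀ x F, G.IsLeftFace x F ↔ f x = F := fun x F =>
    ⟨fun h => (hf x).eq h, fun h => h ▸ hf x⟩
  have hcard : ∀ F, G.faceEdges F = (Finset.univ.filter fun x => f x = F).card := fun F => by
    rw [faceEdges, Nat.card_eq_fintype_card, Fintype.card_subtype]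
    simp only [hiff]
  rw [finsum_mem_eq_sum_of_inter_support_eq (t := (Finset.univ.image f).filter (· ∈ A))]
  · have hset : {x : G.Dart | ∃ F ∈ A, G.IsLeftFace x F} =
        ((Finset.univ.filter fun x => f x ∈ A : Finset G.Dart) : Set G.Dart) := by
      ext x
      simp [hiff]
    rw [hset, Set.ncard_coe_finset, Finset.card_eq_sum_card_fiberwise (f := f)
      (t := (Finset.univ.image f).filter (· ∈ A)) fun x hx => by simpa using hx]
    refine Finset.sum_congr rfl fun F hF => ?_
    rw [hcard, Finset.filter_filter]
    congr 1
    ext x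
    have := (Finset.mem_filter.1 hF).2
    simp only [Finset.mem_filter, Finset.mem_univ, true_and]
    exact ⟨fun h => ⟨h ▸ this, h⟩, fun h => h.2⟩
  · ext F
    simp only [Set.mem_inter_iff, Function.mem_support, Finset.coe_filter, Finset.mem_image,
      Finset.mem_univ, true_and]
    refine ⟨fun ⟨h1, h2⟩ => ⟨⟨?_, h1⟩, h2⟩, fun ⟨⟨_, h1⟩, h2⟩ => ⟨h1, h2⟩⟩
    rw [hcard] at h2
    obtain ⟨x, hx⟩ := Finset.card_ne_zero.1 h2
    exact ⟨x, (Finset.mem_filter.1 hx).2⟩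

theorem Computation.length_eq [Fintype V] (hG : G.IsPlanar) (hc : G.graph.Connected)
    {E : Set G.Dart} (hE : G.IsEntryChoice s d E) (hn : ∀ v : V, G.pos v ∉ G.line s d)
    {ms : List (Token G)} (h : G.Computation s d E ms 0) :
    ms.length = ∑ᶠ F ∈ G.crossedFaces s d, G.faceEdges F := by
  obtain ⟨S, hlen, hS, hentry, hsource, hsound⟩ := h.exists_visited hG
  rw [hlen, hG.finsum_faceEdges]
  congr 1
  refine (hsound _ (fun κ hκ => hκ.exists_crossed hG hE) fun x => ?_).antisymm ?_
  · exact exists_congr fun F => and_congr_right fun _ => hG.isLeftFace_faceNext.symm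
  · rintro y ⟨F, hF, hy⟩
    exact hG.mem_of_crossed hc hE hn hS hentry hsource hF hy

end GeomGraph

end TwoFace

theorem mainTheorem2 :
    ∃ C : ℕ, ∀ (V : Type*) [Fintype V] (G : TwoFace.GeomGraph V),
      G.graph.Connected → G.IsPlanar →
      ∀ (s d : V) (E : Set G.Dart), G.IsEntryChoice s d E →
      ∀ (ms : List (TwoFace.Token G)) (c : Multiset (TwoFace.Token G)),
        G.Computation s d E ms c →
        ms.length ≤ C * Nat.card G.graph.edgeSet ∧
        (∀ l : List (Fin ms.length), TwoFace.IsCausalChain ms l →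
          l.length ≤ C * Fintype.card V) ∧
        ((∀ v : V, G.pos v ∉ G.line s d) → c = 0 →
          ms.length = ∑ᶠ F ∈ G.crossedFaces s d, G.faceEdges F) := by
  -- The constant is 2 · 3: at most 2|E| messages, and |E| ≤ 3|V|.
  refine ⟨6, fun V _ G hc hG s d E hE ms c h => ⟨?_, fun l hl => ?_, ?_⟩⟩
  · have := h.length_le hG
    omega
  · have h1 := h.length_le hG
    have h2 := hl.length_le
    have h3 := hG.card_edgeSet_le hc
    omega
  · rintro hn rfl
    exact h.length_eq hG hc hE hn
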